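/- Let $n\ge 0$ and $S_n$ be the symmetric group, with product the composition of functions, $s_i=(i\ i{+}1)$, and longest element $w_0$, $w_0(i)=n+1-i$. We identify $w\in S_n$ with the matrix sending $e_j$ to $e_{w(j)}$. Let $B_i(z)\in GL_n(\mathbb C)$ be the matrix that agrees with the identity matrix except that its block in rows and columns $i,i+1$ is $\begin{pmatrix}0&1\\1&z\end{pmatrix}$. For a positive braid word $\beta=\sigma_{i_1}\cdots\sigma_{i_l}$ in the Artin generators $\sigma_1,\dots,\sigma_{n-1}$ put $B_\beta(z)=B_{i_1}(z_1)\cdots B_{i_l}(z_l)$ for $z\in\mathbb C^l$, and let $$X(\beta;w_0)=\{z\in\mathbb C^l : B_\beta(z)\,w_0\ \text{is upper triangular}\}$$ be the braid variety. The Coxeter projection of $\beta$ is $s_{i_1}\cdots s_{i_l}\in S_n$, and $\beta$ is reduced if no shorter word has the same projection. Let $\mathscr{F}\ell_n=GL_n(\mathbb C)/B$ be the variety of complete flags in $\mathbb C^n$, where $A\in GL_n(\mathbb C)$ gives the flag $\mathscr F^A$ whose $k$-th space is spanned by the first $k$ columns of $A$, and $B$ is the group of upper triangular matrices. Let $F^{\mathrm{st}}_p=\langle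 e_1,\dots,e_p\rangle$ and $F^{\mathrm{ant}}_q=\langle e_n,\dots,e_{n-q+1}\rangle$. For $w\in S_n$ the Schubert cell and the opposite Schubert cell are $$\mathring X_w=\{F\in\mathscr{F}\ell_n : \dim(F^{\mathrm{st}}_p\cap F_q)=\#\{i\le p : w(i)\le q\}\ \text{for all } p,q\},$$ $$\mathring X^{w}=\{F\in\mathscr{F}\ell_n : \dim(F_p\cap F^{\mathrm{ant}}_q)=\#\{i\le p : w_0w^{-1}(i)\le q\}\ \text{for all } p,q\},$$ and for $u,w\in S_n$ the open Richardson variety is $\mathcal R_u^w=\mathring X_w\cap\mathring X^u$. Varieties are reduced, that is, sets of complex points with the Zariski topology and their regular functions. **(1)** Let $\beta_1,\beta_2$ be reduced positive braid words on $n$ strands, of lengths $l_1,l_2$ and with Coxeter projections $w_1,w_2\in S_n$. Then the map $$\mathbb C^{l_1}\times\mathbb C^{l_2}\to\mathscr{F}\ell_n,\qquad (z_1,z_2)\mapsto\mathscr F^{\,B_{\beta_1}(z_1)^{-1}},$$ restricts to an isomorphism of algebraic varieties $$X(\beta_1\beta_2;w_0)\ \xrightarrow{\ \cong\ }\ \mathring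 X_{w_1}\cap\mathring X^{\,w_0w_2^{-1}}.$$ **(2)** Consequently, for all $u,w\in S_n$ (in particular, whenever $u\le w$ in Bruhat order), reduced words $\beta(w)$ of $w$ and $\beta(u^{-1}w_0)$ of $u^{-1}w_0$ exist, and for every choice of them there is an isomorphism of algebraic varieties $$X(\beta(w)\beta(u^{-1}w_0);w_0)\ \cong\ \mathcal R_u^w .$$ -/

import Mathlib

open Topology

noncomputable section

/-! ### Spaces with functions: classical complex varieties as sets of points -/

/-- A space with functions over `ℂ`: a set of points with a (Zariski) topology and, for every
subset `U`, a notion of which complex valued functions are regular on `U` (only the values of the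
function on `U` matter).  The fields below say that regular functions form a sheaf of
`ℂ`-algebras and that the inverse of a regular function is regular on its non-vanishing locus,
which is open. -/
structure SpaceWithFunctions (X : Type*) where
  zariski : TopologicalSpace X
  IsRegularOn : (X → ℂ) → Set X → Prop
  congr' : ∀ {f g : X → ℂ} {U : Set X}, IsRegularOn f U → Set.EqOn f g U → IsRegularOn g U
  mono' : ∀ {f : X → ℂ} {U V : Set X}, U ⊆ V → IsRegularOn f V → IsRegularOn f U
  glue' : ∀ {f : X → ℂ} {U : Set X},
    (∀ x ∈ U, ∃ V, IsOpen[zariski] V ∧ x ∈ V ∧ IsRegularOn f (U ∩ V)) → IsRegularOn f U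
  const' : ∀ (c : ℂ) (U : Set X), IsRegularOn (fun _ => c) U
  add' : ∀ {f g : X → ℂ} {U : Set X},
    IsRegularOn f U → IsRegularOn g U → IsRegularOn (fun x => f x + g x) U
  mul' : ∀ {f g : X → ℂ} {U : Set X},
    IsRegularOn f U → IsRegularOn g U → IsRegularOn (fun x => f x * g x) U
  isOpen_ne_zero' : ∀ {f : X → ℂ} {U : Set X}, IsOpen[zariski] U → IsRegularOn f U →
    IsOpen[zariski] {x | x ∈ U ∧ f x ≠ 0}
  inv' : ∀ {f : X → ℂ} {U : Set X}, IsRegularOn f U → (∀ x ∈ U, f x ≠ 0) →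
    IsRegularOn (fun x => (f x)⁻¹) U

namespace SpaceWithFunctions

variable {X Y : Type*}

/-- A morphism: a continuous map that pulls regular functions on open sets back to regular
functions. -/
def IsMorphism (S : SpaceWithFunctions X) (T : SpaceWithFunctions Y) (φ : X → Y) : Prop :=
  Continuous[S.zariski, T.zariski] φ ∧
    ∀ (V : Set Y) (f : Y → ℂ), IsOpen[T.zariski] V → T.IsRegularOn f V →
      S.IsRegularOn (f ∘ φ) (φ ⁻¹' V)

/-- An isomorphism: a bijection that is a morphism in both directions. -/
structure Iso (S : SpaceWithFunctions X) (T : SpaceWithFunctions Y) extends X ≃ Y where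
  isMorphism_toFun : S.IsMorphism T toFun
  isMorphism_invFun : T.IsMorphism S invFun

/-- The Zariski topology on the affine space `ℂ^σ`, with the basis of open sets
`{P ≠ 0}`, for `P` a polynomial. -/
@[reducible] def affineZariski (σ : Type*) : TopologicalSpace (σ → ℂ) :=
  TopologicalSpace.generateFrom
    (Set.range fun P : MvPolynomial σ ℂ => {x : σ → ℂ | MvPolynomial.eval x P ≠ 0})

/-- The affine space `ℂ^σ`: regular functions are locally quotients of polynomials. -/
def affine (σ : Type*) : SpaceWithFunctions (σ → ℂ) where
  zariski := affineZariski σ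
  IsRegularOn f U := ∀ x ∈ U, ∃ V, IsOpen[affineZariski σ] V ∧ x ∈ V ∧
    ∃ P Q : MvPolynomial σ ℂ, ∀ y ∈ U ∩ V,
      MvPolynomial.eval y Q ≠ 0 ∧ f y = MvPolynomial.eval y P / MvPolynomial.eval y Q
  congr' := by
    intro f g U hf hfg x hx
    obtain ⟨V, hV, hxV, P, Q, h⟩ := hf x hx
    exact ⟨V, hV, hxV, P, Q, fun y hy => ⟨(h y hy).1, (hfg hy.1) ▸ (h y hy).2⟩⟩
  mono' := by
    intro f U V hUV hf x hx
    obtain ⟨W, hW, hxW, P, Q, h⟩ := hf x (hUV hx)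
    exact ⟨W, hW, hxW, P, Q, fun y hy => h y ⟨hUV hy.1, hy.2⟩⟩
  glue' := by
    intro f U h x hx
    obtain ⟨V, hV, hxV, hf⟩ := h x hx
    obtain ⟨W, hW, hxW, P, Q, h⟩ := hf x ⟨hx, hxV⟩
    exact ⟨V ∩ W, @IsOpen.inter _ (affineZariski σ) _ _ hV hW, ⟨hxV, hxW⟩, P, Q,
      fun y hy => h y ⟨⟨hy.1, hy.2.1⟩, hy.2.2⟩⟩
  const' := by
    intro c U x _
    exact ⟨Set.univ, @isOpen_univ _ (affineZariski σ), trivial, MvPolynomial.C c, 1, by simp⟩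
  add' := by
    intro f g U hf hg x hx
    obtain ⟨V, hV, hxV, P, Q, h⟩ := hf x hx
    obtain ⟨W, hW, hxW, P', Q', h'⟩ := hg x hx
    refine ⟨V ∩ W, @IsOpen.inter _ (affineZariski σ) _ _ hV hW, ⟨hxV, hxW⟩,
      P * Q' + Q * P', Q * Q', fun y hy => ?_⟩
    obtain ⟨h1, h2⟩ := h y ⟨hy.1, hy.2.1⟩
    obtain ⟨h3, h4⟩ := h' y ⟨hy.1, hy.2.2⟩
    refine ⟨by simp [h1, h3], ?_⟩
    beta_reduce
    rw [h2, h4, div_add_div _ _ h1 h3]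
    simp
  mul' := by
    intro f g U hf hg x hx
    obtain ⟨V, hV, hxV, P, Q, h⟩ := hf x hx
    obtain ⟨W, hW, hxW, P', Q', h'⟩ := hg x hx
    refine ⟨V ∩ W, @IsOpen.inter _ (affineZariski σ) _ _ hV hW, ⟨hxV, hxW⟩,
      P * P', Q * Q', fun y hy => ?_⟩
    obtain ⟨h1, h2⟩ := h y ⟨hy.1, hy.2.1⟩
    obtain ⟨h3, h4⟩ := h' y ⟨hy.1, hy.2.2⟩
    refine ⟨by simp [h1, h3], ?_⟩
    beta_reduce
    rw [h2, h4, div_mul_div_comm]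
    simp
  isOpen_ne_zero' := by
    intro f U hU hf
    refine (@isOpen_iff_forall_mem_open _ (affineZariski σ) _).2 ?_
    rintro x ⟨hx, hfx⟩
    obtain ⟨V, hV, hxV, P, Q, h⟩ := hf x hx
    refine ⟨(U ∩ V) ∩ {y | MvPolynomial.eval y P ≠ 0}, ?_, ?_, ⟨hx, hxV⟩, ?_⟩
    · rintro y ⟨hy, hP⟩
      refine ⟨hy.1, ?_⟩
      rw [(h y hy).2]
      exact div_ne_zero hP (h y hy).1
    · exact @IsOpen.inter _ (affineZariski σ) _ _
        (@IsOpen.inter _ (affineZariski σ) _ _ hU hV)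
        (TopologicalSpace.isOpen_generateFrom_of_mem ⟨P, rfl⟩)
    · intro h0
      apply hfx
      rw [(h x ⟨hx, hxV⟩).2]
      simp [h0]
  inv' := by
    intro f U hf h0 x hx
    obtain ⟨V, hV, hxV, P, Q, h⟩ := hf x hx
    refine ⟨V, hV, hxV, Q, P, fun y hy => ?_⟩
    have h1 := h0 y hy.1
    beta_reduce
    rw [(h y hy).2] at h1 ⊢
    exact ⟨fun hP => h1 (by simp [hP]), by rw [inv_div]⟩

/-- The structure induced along a map `i : Y → X`: the induced topology, and
functions that locally are restrictions of regular functions on open subsets of `X`.  It is used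
for inclusions of subsets. -/
def induced (i : Y → X) (S : SpaceWithFunctions X) : SpaceWithFunctions Y where
  zariski := TopologicalSpace.induced i S.zariski
  IsRegularOn f U := ∀ y ∈ U, ∃ W, IsOpen[S.zariski] W ∧ i y ∈ W ∧
    ∃ g : X → ℂ, S.IsRegularOn g W ∧ ∀ y' ∈ U, i y' ∈ W → f y' = g (i y')
  congr' := by
    intro f g U hf hfg x hx
    obtain ⟨W, hW, hxW, k, hk, h⟩ := hf x hx
    exact ⟨W, hW, hxW, k, hk, fun y hy hyW => (hfg hy) ▸ h y hy hyW⟩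
  mono' := by
    intro f U V hUV hf x hx
    obtain ⟨W, hW, hxW, k, hk, h⟩ := hf x (hUV hx)
    exact ⟨W, hW, hxW, k, hk, fun y hy hyW => h y (hUV hy) hyW⟩
  glue' := by
    intro f U h x hx
    obtain ⟨V, hV, hxV, hf⟩ := h x hx
    obtain ⟨V', hV', rfl⟩ := hV
    obtain ⟨W, hW, hxW, k, hk, h⟩ := hf x ⟨hx, hxV⟩
    exact ⟨W ∩ V', @IsOpen.inter _ S.zariski _ _ hW hV', ⟨hxW, hxV⟩, k,
      S.mono' Set.inter_subset_left hk, fun y hy hyW => h y ⟨hy, hyW.2⟩ hyW.1⟩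
  const' := fun c U x _ => ⟨Set.univ, @isOpen_univ _ S.zariski, trivial, fun _ => c,
    S.const' c _, fun _ _ _ => rfl⟩
  add' := by
    intro f g U hf hg x hx
    obtain ⟨W, hW, hxW, k, hk, h⟩ := hf x hx
    obtain ⟨W', hW', hxW', k', hk', h'⟩ := hg x hx
    exact ⟨W ∩ W', @IsOpen.inter _ S.zariski _ _ hW hW', ⟨hxW, hxW'⟩, _,
      S.add' (S.mono' Set.inter_subset_left hk) (S.mono' Set.inter_subset_right hk'),
      fun y hy hyW => by beta_reduce; rw [h y hy hyW.1, h' y hy hyW.2]⟩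
  mul' := by
    intro f g U hf hg x hx
    obtain ⟨W, hW, hxW, k, hk, h⟩ := hf x hx
    obtain ⟨W', hW', hxW', k', hk', h'⟩ := hg x hx
    exact ⟨W ∩ W', @IsOpen.inter _ S.zariski _ _ hW hW', ⟨hxW, hxW'⟩, _,
      S.mul' (S.mono' Set.inter_subset_left hk) (S.mono' Set.inter_subset_right hk'),
      fun y hy hyW => by beta_reduce; rw [h y hy hyW.1, h' y hy hyW.2]⟩
  isOpen_ne_zero' := by
    intro f U hU hf
    refine (@isOpen_iff_forall_mem_open _ (TopologicalSpace.induced i S.zariski) _).2 ?_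
    obtain ⟨U', hU', rfl⟩ := hU
    rintro x ⟨hx, hfx⟩
    obtain ⟨W, hW, hxW, k, hk, h⟩ := hf x hx
    refine ⟨i ⁻¹' (U' ∩ {z | z ∈ W ∧ k z ≠ 0}), ?_,
      ⟨_, @IsOpen.inter _ S.zariski _ _ hU' (S.isOpen_ne_zero' hW hk), rfl⟩, hx, hxW, ?_⟩
    · rintro y ⟨hy, hyW, hky⟩
      exact ⟨hy, by rwa [h y hy hyW]⟩
    · rwa [← h x hx hxW]
  inv' := by
    intro f U hf h0 x hx
    obtain ⟨W, hW, hxW, k, hk, h⟩ := hf x hx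
    refine ⟨{z | z ∈ W ∧ k z ≠ 0}, S.isOpen_ne_zero' hW hk, ⟨hxW, ?_⟩, fun z => (k z)⁻¹,
      S.inv' (S.mono' (fun z hz => hz.1) hk) (fun z hz => hz.2), fun y hy hyW => ?_⟩
    · rw [← h x hx hxW]
      exact h0 x hx
    · beta_reduce
      rw [h y hy hyW.1]

/-- The induced structure on a subset. -/
def restrict (S : SpaceWithFunctions X) (Z : Set X) : SpaceWithFunctions Z :=
  induced Subtype.val S

/-- The quotient structure along a map `π : X → Y`: the quotient topology, and the functions
whose pull-back to `X` is regular. -/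
def coinduced (π : X → Y) (S : SpaceWithFunctions X) : SpaceWithFunctions Y where
  zariski := TopologicalSpace.coinduced π S.zariski
  IsRegularOn f U := S.IsRegularOn (f ∘ π) (π ⁻¹' U)
  congr' := fun hf hfg => S.congr' hf (fun x hx => hfg hx)
  mono' := fun hUV hf => S.mono' (Set.preimage_mono hUV) hf
  glue' := by
    intro f U h
    refine S.glue' fun x hx => ?_
    obtain ⟨V, hV, hxV, hf⟩ := h (π x) hx
    exact ⟨π ⁻¹' V, isOpen_coinduced.1 hV, hxV, hf⟩
  const' := fun c U => S.const' c _
  add' := fun hf hg => S.add' hf hg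
  mul' := fun hf hg => S.mul' hf hg
  isOpen_ne_zero' := fun hU hf =>
    isOpen_coinduced.2 (S.isOpen_ne_zero' (isOpen_coinduced.1 hU) hf)
  inv' := fun hf h0 => S.inv' hf (fun x hx => h0 (π x) hx)

end SpaceWithFunctions

namespace BraidRichardson

/-! ### Braid words and their Coxeter projections -/

/-- A positive braid word of length `l` in the Artin generators of the braid group on `n`
strands.  The letter `i : Fin (n - 1)` is the generator that crosses the strands in the
(zero-based) positions `i` and `i + 1`.  The product of words is `Fin.append`. -/
abbrev PositiveWord (n l : ℕ) : Type := Fin l → Fin (n - 1)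

/-- The first of the two positions that the generator `i` crosses. -/
def lo {n : ℕ} (i : Fin (n - 1)) : Fin n := ⟨i, by omega⟩

/-- The second of the two positions that the generator `i` crosses. -/
def hi {n : ℕ} (i : Fin (n - 1)) : Fin n := ⟨i + 1, by omega⟩

/-- The Coxeter projection `s_{i_1} ⋯ s_{i_l}` of the word `σ_{i_1} ⋯ σ_{i_l}`; the product of
permutations is the composition of functions. -/
def coxeter {n l : ℕ} (β : PositiveWord n l) : Equiv.Perm (Fin n) :=
  (List.ofFn fun k => Equiv.swap (lo (β k)) (hi (β k))).prod

/-- A word is reduced if no shorter word has the same Coxeter projection. -/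
def IsReducedWord {n l : ℕ} (β : PositiveWord n l) : Prop :=
  ∀ (m : ℕ) (γ : PositiveWord n m), coxeter γ = coxeter β → l ≤ m

/-- `β` is a reduced word for `w`, that is, a word for the positive braid lift of `w`. -/
def IsReducedWordOf {n l : ℕ} (β : PositiveWord n l) (w : Equiv.Perm (Fin n)) : Prop :=
  IsReducedWord β ∧ coxeter β = w

/-! ### Braid matrices and braid varieties -/

/-- The matrix `B_i(z)`. -/
def braidMatrix {n : ℕ} (i : Fin (n - 1)) (z : ℂ) : Matrix (Fin n) (Fin n) ℂ :=
  Matrix.of fun j k =>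
    if j = k ∧ j ≠ lo i ∧ j ≠ hi i then 1
    else if (j = lo i ∧ k = hi i) ∨ (j = hi i ∧ k = lo i) then 1
    else if j = hi i ∧ k = hi i then z
    else 0

/-- The inverse of `B_i(z)`. -/
def braidMatrixInv {n : ℕ} (i : Fin (n - 1)) (z : ℂ) : Matrix (Fin n) (Fin n) ℂ :=
  Matrix.of fun j k =>
    if j = k ∧ j ≠ lo i ∧ j ≠ hi i then 1
    else if (j = lo i ∧ k = hi i) ∨ (j = hi i ∧ k = lo i) then 1
    else if j = lo i ∧ k = lo i then -z
    else 0

theorem lo_ne_hi {n : ℕ} (i : Fin (n - 1)) : lo i ≠ hi i := by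
  simp [lo, hi]

theorem braidMatrix_mul_inv {n : ℕ} (i : Fin (n - 1)) (z : ℂ) :
    braidMatrix i z * braidMatrixInv i z = 1 := by
  have hne := lo_ne_hi i
  have key : ∀ j k, braidMatrix i z j k =
      if j = lo i then (if k = hi i then 1 else 0)
      else if j = hi i then (if k = lo i then 1 else 0) + (if k = hi i then z else 0)
      else (if k = j then 1 else 0) := by
    intro j k
    simp only [braidMatrix, Matrix.of_apply]
    grind
  have sum : ∀ (C : Matrix (Fin n) (Fin n) ℂ) (j l : Fin n), (braidMatrix i z * C) j l =
      if j = lo i then C (hi i) l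
      else if j = hi i then C (lo i) l + z * C (hi i) l
      else C j l := by
    intro C j l
    rw [Matrix.mul_apply]
    simp only [key]
    by_cases h1 : j = lo i
    · simp [h1]
    · by_cases h2 : j = hi i
      · simp [h2, hne.symm, add_mul, Finset.sum_add_distrib]
      · simp [h1, h2]
  ext j l
  rw [sum]
  simp only [braidMatrixInv, Matrix.of_apply, Matrix.one_apply]
  grind

/-- The matrix `B_i(z)` as an element of `GL_n(ℂ)`. -/
def braidGL {n : ℕ} (i : Fin (n - 1)) (z : ℂ) : GL (Fin n) ℂ where
  val := braidMatrix i z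
  inv := braidMatrixInv i z
  val_inv := braidMatrix_mul_inv i z
  inv_val := mul_eq_one_comm.1 (braidMatrix_mul_inv i z)

/-- The matrix `B_β(z_1, …, z_l) = B_{i_1}(z_1) ⋯ B_{i_l}(z_l)`, for the word
`β = σ_{i_1} ⋯ σ_{i_l}`. -/
def wordGL {n l : ℕ} (β : PositiveWord n l) (z : Fin l → ℂ) : GL (Fin n) ℂ :=
  (List.ofFn fun k => braidGL (β k) (z k)).prod

/-- The matrix of a permutation `w`; it sends the basis vector `e_j` to `e_{w(j)}`. -/
def permMatrix {n : ℕ} (w : Equiv.Perm (Fin n)) : Matrix (Fin n) (Fin n) ℂ :=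
  Matrix.of fun i j => if i = w j then 1 else 0

/-- The longest permutation `w_0`, which reverses `Fin n`. -/
def w0 (n : ℕ) : Equiv.Perm (Fin n) := Fin.revPerm

/-- The braid variety `X(β; π)`, the set of all `z ∈ ℂ^l` such that `B_β(z) π` is upper
triangular. -/
def braidVariety {n l : ℕ} (β : PositiveWord n l) (π : Equiv.Perm (Fin n)) : Set (Fin l → ℂ) :=
  {z | Matrix.BlockTriangular
    ((wordGL β z : Matrix (Fin n) (Fin n) ℂ) * permMatrix π) id}

/-- The braid variety as a closed subvariety of affine space. -/
def braidVarietySpace {n l : ℕ} (β : PositiveWord n l) (π : Equiv.Perm (Fin n)) :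
    SpaceWithFunctions (braidVariety β π) :=
  (SpaceWithFunctions.affine (Fin l)).restrict (braidVariety β π)

/-! ### The flag variety -/

/-- A complete flag in `ℂ^n`. -/
structure CompleteFlag (n : ℕ) where
  space : Fin (n + 1) → Submodule ℂ (Fin n → ℂ)
  monotone_space : Monotone space
  finrank_space : ∀ k, Module.finrank ℂ (space k) = k

/-- The span of the first `k` vectors of the family `v`. -/
def spanFirst {n : ℕ} (v : Fin n → Fin n → ℂ) (k : Fin (n + 1)) : Submodule ℂ (Fin n → ℂ) :=
  Submodule.span ℂ (v '' {j | (j : ℕ) < k})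

theorem finrank_spanFirst {n : ℕ} {v : Fin n → Fin n → ℂ} (hv : LinearIndependent ℂ v)
    (k : Fin (n + 1)) : Module.finrank ℂ (spanFirst v k) = k := by
  classical
  have h : v '' {j | (j : ℕ) < k} = Set.range fun j : {j : Fin n // (j : ℕ) < k} => v j := by
    ext x
    simp
  have h' := finrank_span_eq_card (hv.comp (fun j : {j : Fin n // (j : ℕ) < k} => (j : Fin n))
    Subtype.val_injective)
  rw [Fintype.card_subtype] at h'
  rw [spanFirst, h]
  refine h'.trans ?_
  have hk : (k : ℕ) ≤ n := by omega
  rw [Fin.card_filter_val_lt]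
  exact min_eq_right hk

/-- The flag of an invertible matrix: its `k`-th space is spanned by the first `k` columns. -/
def flagOf {n : ℕ} (A : GL (Fin n) ℂ) : CompleteFlag n where
  space := spanFirst fun j => (A : Matrix (Fin n) (Fin n) ℂ).col j
  monotone_space := fun _ _ h => Submodule.span_mono
    (Set.image_mono fun _ hj => lt_of_lt_of_le (b := ((_ : Fin (n + 1)) : ℕ)) hj h)
  finrank_space := finrank_spanFirst
    (Matrix.linearIndependent_cols_iff_isUnit.2 A.isUnit)

/-- `GL_n(ℂ)` as an open subvariety of the affine space of matrices. -/
def generalLinearSpace (n : ℕ) : SpaceWithFunctions (GL (Fin n) ℂ) :=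
  SpaceWithFunctions.induced
    (fun (A : GL (Fin n) ℂ) (p : Fin n × Fin n) => (A : Matrix (Fin n) (Fin n) ℂ) p.1 p.2)
    (SpaceWithFunctions.affine (Fin n × Fin n))

/-- The flag variety `GL_n(ℂ) / B`: the set of complete flags with the quotient structure along
the surjection `A ↦ flagOf A`, whose fibres are the cosets of the group `B` of upper triangular
matrices. -/
def flagVariety (n : ℕ) : SpaceWithFunctions (CompleteFlag n) :=
  SpaceWithFunctions.coinduced flagOf (generalLinearSpace n)

/-! ### Schubert cells and open Richardson varieties -/

/-- The `p`-th space of the standard flag, the span of the first `p` basis vectors. -/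
def stdSpace (n : ℕ) (p : Fin (n + 1)) : Submodule ℂ (Fin n → ℂ) :=
  spanFirst (fun j => Pi.single j 1) p

/-- The `q`-th space of the anti-standard flag, the span of the last `q` basis vectors. -/
def antSpace (n : ℕ) (q : Fin (n + 1)) : Submodule ℂ (Fin n → ℂ) :=
  spanFirst (fun j => Pi.single j.rev 1) q

/-- The Schubert cell of `w`: the flags `F` with
`dim (F^st_p ∩ F_q) = #{i ≤ p | w(i) ≤ q}` for all `p`, `q` (with one-based `i` and `w(i)`). -/
def schubertCell {n : ℕ} (w : Equiv.Perm (Fin n)) : Set (CompleteFlag n) :=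
  {F | ∀ p q : Fin (n + 1), Module.finrank ℂ (stdSpace n p ⊓ F.space q : Submodule ℂ _) =
    (Finset.univ.filter fun i : Fin n => (i : ℕ) < p ∧ (w i : ℕ) < q).card}

/-- The opposite Schubert cell of `w`: the flags `F` with
`dim (F_p ∩ F^ant_q) = #{i ≤ p | w_0 w⁻¹ (i) ≤ q}` for all `p`, `q`.  Like the Schubert cell of
`w`, it contains the coordinate flag of the matrix of `w⁻¹`. -/
def oppositeSchubertCell {n : ℕ} (w : Equiv.Perm (Fin n)) : Set (CompleteFlag n) :=
  {F | ∀ p q : Fin (n + 1), Module.finrank ℂ (F.space p ⊓ antSpace n q : Submodule ℂ _) =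
    (Finset.univ.filter fun i : Fin n => (i : ℕ) < p ∧ ((w0 n * w⁻¹) i : ℕ) < q).card}

/-- The open Richardson variety of `u` and `w`. -/
def openRichardson {n : ℕ} (u w : Equiv.Perm (Fin n)) : Set (CompleteFlag n) :=
  schubertCell w ∩ oppositeSchubertCell u

/-- A subset of the flag variety with the induced structure. -/
def flagSubspace {n : ℕ} (Z : Set (CompleteFlag n)) : SpaceWithFunctions Z :=
  (flagVariety n).restrict Z

end BraidRichardson

end

open BraidRichardson

noncomputable section

/-! ### Morphisms into affine, induced and quotient structures -/

namespace SpaceWithFunctions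

variable {X Y Z : Type*}

/-! The matrix `B_{β₁}(z₁) B_{β₂}(z₂) w₀` is upper triangular exactly when `B_{β₁}(z₁)⁻¹` and
`B_{β₂}(z₂) w₀` define the same flag (`mem_braidVariety_append_iff`). The braid variety is thus a
fibre product over the flag variety, and it becomes an intersection of cells once each factor is
shown to parametrize its own cell.

For a reduced word of `w`, the flags of `B_β(z)⁻¹` fill the Schubert cell of `w`
(`flagOf_mem_schubertCell_iff`). This is an induction on the length: if `w s_i` is longer than `w`,
a flag lies in the cell of `w s_i` iff some `B_i(z)` moves it into the cell of `w`. The second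
factor reduces to the first, because conjugation by `w₀` turns `B_i(z)` into the inverse of a braid
matrix (`wordGL_mul_permGL_w0`) and exchanges the standard and anti-standard flags.

The inverse map is regular because `w B_β(z)⁻¹` is lower unitriangular (`wordGL_inv_apply`). It is
therefore the canonical representative of a flag in the big cell, with entries given by quotients of
minors (`exists_regular_section`), and the parameters are polynomials in these entries
(`exists_polynomial_parameter`). So the parameters extend to regular functions on an open set of
flags (`exists_regular_parameter`), which also gives injectivity. -/

theorem IsMorphism.comp {S : SpaceWithFunctions X} {T : SpaceWithFunctions Y}
    {R : SpaceWithFunctions Z} {ψ : Y → Z} {φ : X → Y}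
    (hψ : T.IsMorphism R ψ) (hφ : S.IsMorphism T φ) : S.IsMorphism R (ψ ∘ φ) := by
  let := S.zariski
  let := T.zariski
  let := R.zariski
  refine ⟨hψ.1.comp hφ.1, fun V f hV hf => ?_⟩
  exact hφ.2 (ψ ⁻¹' V) (f ∘ ψ) (hV.preimage hψ.1) (hψ.2 V f hV hf)

theorem isMorphism_induced (S : SpaceWithFunctions X) (i : Y → X) :
    (induced i S).IsMorphism S i := by
  refine ⟨continuous_iff_le_induced.2 le_rfl, fun V f hV hf y hy => ?_⟩
  exact ⟨V, hV, hy, f, hf, fun _ _ _ => rfl⟩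

/-- The universal property of the induced structure: a function regular for it is locally pulled
back from `X`, and regularity on `Z` can be checked locally. -/
theorem IsMorphism.to_induced {S : SpaceWithFunctions X} {T : SpaceWithFunctions Z} {i : Y → X}
    {ψ : Z → Y} (h : T.IsMorphism S (i ∘ ψ)) : T.IsMorphism (induced i S) ψ := by
  refine ⟨continuous_induced_rng.2 h.1, fun V f hV hf => T.glue' fun x hx => ?_⟩
  obtain ⟨W, hW, hxW, g, hg, hfg⟩ := hf (ψ x) hx
  refine ⟨(i ∘ ψ) ⁻¹' W, @IsOpen.preimage _ _ T.zariski S.zariski _ h.1 _ hW, hxW, ?_⟩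
  refine T.congr' (T.mono' Set.inter_subset_right (h.2 W g hW hg)) fun y hy => ?_
  exact (hfg (ψ y) hy.1 hy.2).symm

theorem isMorphism_coinduced (S : SpaceWithFunctions X) (π : X → Y) :
    S.IsMorphism (coinduced π S) π :=
  ⟨continuous_iff_coinduced_le.2 le_rfl, fun _ _ _ hf => hf⟩

theorem isRegularOn_eval (S : SpaceWithFunctions X) {σ : Type*} {f : σ → X → ℂ} {U : Set X}
    (hf : ∀ i, S.IsRegularOn (f i) U) (P : MvPolynomial σ ℂ) :
    S.IsRegularOn (fun x => MvPolynomial.eval (fun i => f i x) P) U := by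
  induction P using MvPolynomial.induction_on with
  | C a => simpa using S.const' a U
  | add p q hp hq => simpa using S.add' hp hq
  | mul_X p i hp => simpa using S.mul' hp (hf i)

theorem isRegularOn_coord {σ : Type*} (i : σ) (U : Set (σ → ℂ)) :
    (affine σ).IsRegularOn (fun x => x i) U := fun x _ =>
  ⟨Set.univ, @isOpen_univ _ (affineZariski σ), trivial, MvPolynomial.X i, 1, by simp⟩

/-- A map to an affine space is a morphism as soon as its coordinates are regular. -/
theorem isMorphism_affine {σ : Type*} (T : SpaceWithFunctions Y) {ψ : Y → σ → ℂ}
    (h : ∀ i, T.IsRegularOn (fun y => ψ y i) Set.univ) : T.IsMorphism (affine σ) ψ := by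
  have hev := fun P : MvPolynomial σ ℂ => T.isRegularOn_eval h P
  have hc : Continuous[T.zariski, affineZariski σ] ψ := by
    let := T.zariski
    refine continuous_generateFrom_iff.2 ?_
    rintro _ ⟨P, rfl⟩
    simpa using T.isOpen_ne_zero' isOpen_univ (hev P)
  refine ⟨hc, fun V f hV hf => T.glue' fun y hy => ?_⟩
  obtain ⟨W, hW, hyW, P, Q, hPQ⟩ := hf (ψ y) hy
  refine ⟨ψ ⁻¹' W, @IsOpen.preimage _ _ T.zariski (affineZariski σ) _ hc _ hW, hyW, ?_⟩
  refine T.congr' (T.mul' (T.mono' (Set.subset_univ _) (hev P))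
    (T.inv' (T.mono' (Set.subset_univ _) (hev Q)) fun x hx => (hPQ _ hx).1)) fun x hx => ?_
  exact ((hPQ _ hx).2.trans (div_eq_mul_inv _ _)).symm

/-- Functions on a subset that extend to an open neighbourhood are regular. -/
theorem isRegularOn_restrict (S : SpaceWithFunctions X) {A : Set X} {f : A → ℂ} {W : Set X}
    {g : X → ℂ} (hW : IsOpen[S.zariski] W) (hAW : A ⊆ W) (hg : S.IsRegularOn g W)
    (hfg : ∀ x : A, f x = g x) : (S.restrict A).IsRegularOn f Set.univ := fun x _ =>
  ⟨W, hW, hAW x.2, g, hg, fun y _ _ => hfg y⟩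

end SpaceWithFunctions

namespace BraidRichardson

variable {n l : ℕ}

/-! ### Flags and invertible matrices -/

theorem CompleteFlag.ext_space {F G : CompleteFlag n} (h : ∀ k, F.space k = G.space k) : F = G := by
  cases F
  cases G
  congr
  exact funext h

theorem mem_stdSpace {p : Fin (n + 1)} {v : Fin n → ℂ} :
    v ∈ stdSpace n p ↔ ∀ j : Fin n, (p : ℕ) ≤ j → v j = 0 := by
  constructor
  · intro hv j hj
    have hle : stdSpace n p ≤ LinearMap.ker (LinearMap.proj j : (Fin n → ℂ) →ₗ[ℂ] ℂ) := by
      refine Submodule.span_le.2 ?_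
      rintro _ ⟨i, hi, rfl⟩
      have hij : j ≠ i := by
        rintro rfl
        exact absurd hi (not_lt.2 hj)
      simp [Pi.single_eq_of_ne hij]
    simpa using hle hv
  · intro hv
    rw [← Finset.univ_sum_single v]
    refine Submodule.sum_mem _ fun j _ => ?_
    by_cases hj : (j : ℕ) < p
    · have : (Pi.single j (v j) : Fin n → ℂ) = v j • Pi.single j 1 := by
        rw [← Pi.single_smul, smul_eq_mul, mul_one]
      rw [this]
      exact Submodule.smul_mem _ _ (Submodule.subset_span ⟨j, hj, rfl⟩)
    · rw [hv j (not_lt.1 hj), Pi.single_zero]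
      exact Submodule.zero_mem _

/-- The linear automorphism of `ℂ^n` given by an invertible matrix. -/
def glEquiv (g : GL (Fin n) ℂ) : (Fin n → ℂ) ≃ₗ[ℂ] (Fin n → ℂ) :=
  Matrix.toLin'OfInv (M := (g⁻¹ : GL (Fin n) ℂ).1) (M' := g.1) (by simp) (by simp)

theorem glEquiv_apply (g : GL (Fin n) ℂ) (v : Fin n → ℂ) : glEquiv g v = g.1.mulVec v := rfl

theorem flagOf_mul_space (g A : GL (Fin n) ℂ) (k : Fin (n + 1)) :
    (flagOf (g * A)).space k = ((flagOf A).space k).map (glEquiv g).toLinearMap := by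
  simp only [flagOf, spanFirst, Submodule.map_span, ← Set.image_comp]
  congr 1

theorem flagOf_mul_congr {A A' : GL (Fin n) ℂ} (g : GL (Fin n) ℂ) (h : flagOf A = flagOf A') :
    flagOf (g * A) = flagOf (g * A') :=
  CompleteFlag.ext_space fun k => by rw [flagOf_mul_space, flagOf_mul_space, h]

theorem flagOf_mul_eq_iff {A A' : GL (Fin n) ℂ} (g : GL (Fin n) ℂ) :
    flagOf (g * A) = flagOf (g * A') ↔ flagOf A = flagOf A' :=
  ⟨fun h => by simpa using flagOf_mul_congr g⁻¹ h, flagOf_mul_congr g⟩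

theorem flagOf_one_space (k : Fin (n + 1)) : (flagOf (1 : GL (Fin n) ℂ)).space k = stdSpace n k := by
  simp only [flagOf, stdSpace]
  congr 1
  ext i j
  simp [Matrix.one_apply, Pi.single_apply]

theorem flagOf_eq_flagOf_one_iff {T : GL (Fin n) ℂ} :
    flagOf T = flagOf 1 ↔ Matrix.BlockTriangular (T : Matrix (Fin n) (Fin n) ℂ) id := by
  constructor
  · intro h i j hij
    have hmem : (T : Matrix (Fin n) (Fin n) ℂ).col j ∈ (flagOf T).space j.succ :=
      Submodule.subset_span ⟨j, by simp, rfl⟩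
    rw [h, flagOf_one_space, mem_stdSpace] at hmem
    exact hmem i hij
  · intro h
    refine CompleteFlag.ext_space fun k => ?_
    refine Submodule.eq_of_le_of_finrank_eq ?_
      (((flagOf T).finrank_space k).trans ((flagOf 1).finrank_space k).symm)
    refine Submodule.span_le.2 ?_
    rintro _ ⟨j, hj, rfl⟩
    rw [flagOf_one_space]
    exact mem_stdSpace.2 fun i hi => h (lt_of_lt_of_le (Fin.lt_def.2 (lt_of_lt_of_le hj hi)) le_rfl)

/-- The fibres of `flagOf` are the cosets of the upper triangular group; left translation reduces
this to the standard flag. -/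
theorem flagOf_eq_flagOf_iff {A A' : GL (Fin n) ℂ} :
    flagOf A = flagOf A' ↔
      Matrix.BlockTriangular ((A'⁻¹ * A : GL (Fin n) ℂ) : Matrix (Fin n) (Fin n) ℂ) id := by
  rw [← flagOf_eq_flagOf_one_iff, ← flagOf_mul_eq_iff A'⁻¹, inv_mul_cancel]

/-- Choosing one vector in each step of the flag outside the preceding step gives a basis: in a
linear relation, the vector of largest index with non-zero coefficient would lie in the preceding
step. -/
theorem flagOf_surjective : Function.Surjective (flagOf (n := n)) := by
  intro F
  have hlt : ∀ j : Fin n, F.space j.castSucc < F.space j.succ := by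
    intro j
    refine lt_of_le_of_ne (F.monotone_space (Fin.castSucc_lt_succ (i := j)).le) fun h => ?_
    have h1 := F.finrank_space j.castSucc
    rw [h, F.finrank_space] at h1
    simp at h1
  choose v hv hv' using fun j => SetLike.exists_of_lt (hlt j)
  have hmem : ∀ (j : Fin n) (k : Fin (n + 1)), (j : ℕ) < k → v j ∈ F.space k := fun j k hjk =>
    F.monotone_space (a := j.succ) (Fin.le_def.2 (by simpa using hjk)) (hv j)
  have hli : LinearIndependent ℂ v := by
    rw [Fintype.linearIndependent_iff]
    intro g hg
    by_contra! hne
    have hne' : (Finset.univ.filter fun i => g i ≠ 0).Nonempty := by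
      obtain ⟨i, hi⟩ := hne
      exact ⟨i, by simpa using hi⟩
    obtain ⟨j, hj, hmax⟩ := Finset.exists_max_image _ id hne'
    have hj0 : g j ≠ 0 := by simpa using hj
    apply hv' j
    rw [← Finset.add_sum_erase _ _ (Finset.mem_univ j)] at hg
    have h1 : g j • v j ∈ F.space j.castSucc := by
      rw [eq_neg_of_add_eq_zero_left hg]
      refine Submodule.neg_mem _ (Submodule.sum_mem _ fun i hi => ?_)
      by_cases hi0 : g i = 0
      · simp [hi0]
      · refine Submodule.smul_mem _ _ (hmem i _ ?_)
        have h2 := hmax i (by simpa using hi0)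
        exact Fin.lt_def.1 (lt_of_le_of_ne h2 (Finset.ne_of_mem_erase hi))
    exact (Submodule.smul_mem_iff _ hj0).1 h1
  let M : Matrix (Fin n) (Fin n) ℂ := (Matrix.of v).transpose
  have hM : IsUnit M := Matrix.linearIndependent_cols_iff_isUnit.1 hli
  refine ⟨hM.unit, CompleteFlag.ext_space fun k => ?_⟩
  refine Submodule.eq_of_le_of_finrank_eq (Submodule.span_le.2 ?_)
    (((flagOf hM.unit).finrank_space k).trans (F.finrank_space k).symm)
  rintro _ ⟨j, hj, rfl⟩
  exact hmem j k hj

/-! ### Regular sections of the flag variety -/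

/-- The matrix of the rows `0, …, k - 1, j` and the columns `0, …, k` of `A`. -/
def minorMatrix {R : Type*} (A : Matrix (Fin n) (Fin n) R) (j k : Fin n) :
    Matrix {c : Fin n // c ≤ k} {c : Fin n // c ≤ k} R :=
  A.submatrix (fun r => if r.1 = k then j else r.1) Subtype.val

/-- The first `k + 1` columns of `A * T` involve only the first `k + 1` columns of `A`, and
`minorMatrix T k k` is the leading block of `T`. A change of representative of a flag thus scales
all minors with the same `k` by one factor. -/
theorem minorMatrix_mul {A T : Matrix (Fin n) (Fin n) ℂ} (hT : T.BlockTriangular id)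
    (j k : Fin n) : minorMatrix (A * T) j k = minorMatrix A j k * minorMatrix T k k := by
  ext r c
  simp only [minorMatrix, Matrix.submatrix_apply, Matrix.mul_apply]
  rw [← Finset.sum_subset (Finset.subset_univ (Finset.univ.filter fun i => i ≤ k))]
  · rw [Finset.sum_subtype (p := fun i => i ≤ k) _ (by simp)]
    refine Finset.sum_congr rfl fun i _ => ?_
    by_cases hi : i.1 = k
    · simp [hi]
    · simp [hi]
  · intro i _ hi
    have hi' : k < i := by simpa using hi
    rw [hT (lt_of_le_of_lt c.2 hi'), mul_zero]

/-- The inverse is upper triangular as well, so the leading blocks of `T` and `T⁻¹` multiply to the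
identity. -/
theorem det_minorMatrix_ne_zero {T : GL (Fin n) ℂ} (hT : Matrix.BlockTriangular T.1 id)
    (k : Fin n) : (minorMatrix T.1 k k).det ≠ 0 := by
  have hinv : Matrix.BlockTriangular (T⁻¹ : GL (Fin n) ℂ).1 id := by
    have h := flagOf_eq_flagOf_one_iff.2 hT
    rw [← flagOf_mul_eq_iff T⁻¹, inv_mul_cancel, mul_one] at h
    exact flagOf_eq_flagOf_one_iff.1 h.symm
  have h := minorMatrix_mul (A := T.1) hinv k k
  have h1 : minorMatrix (1 : Matrix (Fin n) (Fin n) ℂ) k k = 1 := by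
    ext r c
    by_cases hr : r.1 = k
    · simp [minorMatrix, hr, Matrix.one_apply, Subtype.ext_iff]
    · simp [minorMatrix, hr, Matrix.one_apply, Subtype.ext_iff]
  have h2 : T.1 * (T⁻¹ : GL (Fin n) ℂ).1 = 1 := by simp
  rw [h2, h1] at h
  intro h0
  have h3 := congrArg Matrix.det h
  rw [Matrix.det_mul, h0, zero_mul, Matrix.det_one] at h3
  exact one_ne_zero h3

/-- Lower triangular matrices with ones on the diagonal. -/
def IsLowerUnitriangular (L : Matrix (Fin n) (Fin n) ℂ) : Prop :=
  (∀ i j, i < j → L i j = 0) ∧ ∀ i, L i i = 1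

/-- The minor matrix is again lower triangular, and its diagonal is `1, …, 1, L j k`. -/
theorem det_minorMatrix_of_isLowerUnitriangular {L : Matrix (Fin n) (Fin n) ℂ}
    (hL : IsLowerUnitriangular L) (j k : Fin n) : (minorMatrix L j k).det = L j k := by
  rw [Matrix.det_of_isLowerTriangular, Finset.prod_eq_single (⟨k, le_rfl⟩ : {c : Fin n // c ≤ k})]
  · simp [minorMatrix]
  · intro r _ hr
    have hr' : r.1 ≠ k := fun h => hr (Subtype.ext h)
    simp [minorMatrix, hr', hL.2]
  · simp
  · intro r c hrc
    have hrc' : r.1 < c.1 := hrc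
    have hr' : r.1 ≠ k := (lt_of_lt_of_le hrc' c.2).ne
    simp [minorMatrix, hr', hL.1 _ _ hrc']

/-- The quotient of minors that computes the `(j, k)` entry of the lower unitriangular factor. -/
def minorQuotient (A : Matrix (Fin n) (Fin n) ℂ) (j k : Fin n) : ℂ :=
  (minorMatrix A j k).det / (minorMatrix A k k).det

theorem minorQuotient_congr {A A' : GL (Fin n) ℂ} (h : flagOf A = flagOf A') (M : GL (Fin n) ℂ)
    (j k : Fin n) : minorQuotient (M * A).1 j k = minorQuotient (M * A').1 j k := by
  have hT := flagOf_eq_flagOf_iff.1 h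
  have hA : (M * A).1 = (M * A').1 * (A'⁻¹ * A).1 := by
    rw [← Units.val_mul]
    simp [mul_assoc]
  rw [minorQuotient, minorQuotient, hA, minorMatrix_mul hT, minorMatrix_mul hT, Matrix.det_mul,
    Matrix.det_mul, mul_div_mul_right _ _ (det_minorMatrix_ne_zero hT k)]

theorem det_minorMatrix_ne_zero_congr {A A' : GL (Fin n) ℂ} (h : flagOf A = flagOf A')
    (M : GL (Fin n) ℂ) (k : Fin n) (h0 : (minorMatrix (M * A').1 k k).det ≠ 0) :
    (minorMatrix (M * A).1 k k).det ≠ 0 := by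
  have hT := flagOf_eq_flagOf_iff.1 h
  have hA : (M * A).1 = (M * A').1 * (A'⁻¹ * A).1 := by
    rw [← Units.val_mul]
    simp [mul_assoc]
  rw [hA, minorMatrix_mul hT, Matrix.det_mul]
  exact mul_ne_zero h0 (det_minorMatrix_ne_zero hT k)

theorem exists_polynomial_minor (M : Matrix (Fin n) (Fin n) ℂ) (j k : Fin n) :
    ∃ P : MvPolynomial (Fin n × Fin n) ℂ, ∀ A : Matrix (Fin n) (Fin n) ℂ,
      MvPolynomial.eval (fun q => A q.1 q.2) P = (minorMatrix (M * A) j k).det := by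
  refine ⟨(minorMatrix (M.map MvPolynomial.C * Matrix.mvPolynomialX (Fin n) (Fin n) ℂ) j k).det,
    fun A => ?_⟩
  rw [RingHom.map_det]
  congr 1
  ext r c
  simp [minorMatrix, Matrix.mul_apply]

theorem isRegularOn_minor (M : Matrix (Fin n) (Fin n) ℂ) (j k : Fin n) (U : Set (GL (Fin n) ℂ)) :
    (generalLinearSpace n).IsRegularOn (fun A => (minorMatrix (M * A.1) j k).det) U := by
  obtain ⟨P, hP⟩ := exists_polynomial_minor M j k
  refine SpaceWithFunctions.congr' _ ((generalLinearSpace n).mono' (Set.subset_univ U)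
    ((SpaceWithFunctions.isMorphism_induced _ _).2 Set.univ
      (fun x => MvPolynomial.eval x P) (@isOpen_univ _ (SpaceWithFunctions.affineZariski _))
      (SpaceWithFunctions.isRegularOn_eval _
        (fun i => SpaceWithFunctions.isRegularOn_coord i _) P))) fun A _ => ?_
  exact hP A.1

/-- On the open set of flags `F` such that `M F` is in the big cell, the entries of the
lower unitriangular representative of `M F` are regular functions of `F`. -/
theorem exists_regular_section (M : GL (Fin n) ℂ) :
    ∃ (W : Set (CompleteFlag n)) (s : Fin n → Fin n → CompleteFlag n → ℂ),
      IsOpen[(flagVariety n).zariski] W ∧ (∀ j k, (flagVariety n).IsRegularOn (s j k) W) ∧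
      ∀ A : GL (Fin n) ℂ, IsLowerUnitriangular (M * A).1 →
        flagOf A ∈ W ∧ ∀ j k, s j k (flagOf A) = (M * A).1 j k := by
  -- An arbitrary set-theoretic section suffices: the quotients of minors do not depend on the
  -- representative.
  let rep := Function.surjInv (flagOf_surjective (n := n))
  have hrep : ∀ A, flagOf (rep (flagOf A)) = flagOf A := fun A => Function.surjInv_eq _ _
  let s : Fin n → Fin n → CompleteFlag n → ℂ := fun j k F => minorQuotient (M * rep F).1 j k
  have hs : ∀ j k A, s j k (flagOf A) = minorQuotient (M * A).1 j k := fun j k A =>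
    minorQuotient_congr (hrep A) M j k
  let W : Set (CompleteFlag n) := {F | ∀ k, (minorMatrix (M * rep F).1 k k).det ≠ 0}
  have hW : ∀ A, flagOf A ∈ W ↔ ∀ k, (minorMatrix (M * A).1 k k).det ≠ 0 := fun A =>
    ⟨fun h k => det_minorMatrix_ne_zero_congr (hrep A).symm M k (h k),
      fun h k => det_minorMatrix_ne_zero_congr (hrep A) M k (h k)⟩
  refine ⟨W, s, ?_, fun j k => ?_, fun A hA => ⟨?_, fun j k => ?_⟩⟩
  · refine isOpen_coinduced.2 ?_
    have hpre : flagOf ⁻¹' W = ⋂ k, {A : GL (Fin n) ℂ | A ∈ Set.univ ∧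
        (minorMatrix (M.1 * A.1) k k).det ≠ 0} := by
      ext A
      simp [hW]
    rw [hpre]
    let := (generalLinearSpace n).zariski
    exact isOpen_iInter_of_finite fun k =>
      (generalLinearSpace n).isOpen_ne_zero' isOpen_univ (isRegularOn_minor M.1 k k _)
  · refine SpaceWithFunctions.congr' (generalLinearSpace n) ((generalLinearSpace n).mul'
      (isRegularOn_minor M.1 j k _) ((generalLinearSpace n).inv' (isRegularOn_minor M.1 k k _)
        fun A hA => (hW A).1 hA k)) fun A _ => ?_
    exact (div_eq_mul_inv _ _).symm.trans (hs j k A).symm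
  · rw [hW]
    intro k
    rw [det_minorMatrix_of_isLowerUnitriangular hA, hA.2]
    exact one_ne_zero
  · rw [hs, minorQuotient, det_minorMatrix_of_isLowerUnitriangular hA,
      det_minorMatrix_of_isLowerUnitriangular hA, hA.2, div_one]


/-! ### Reduced words -/

/-- The adjacent transposition that exchanges `lo i` and `hi i`. -/
def simpleSwap (i : Fin (n - 1)) : Equiv.Perm (Fin n) := Equiv.swap (lo i) (hi i)

theorem lo_lt_hi (i : Fin (n - 1)) : lo i < hi i := Fin.lt_def.2 (Nat.lt_succ_self _)

theorem le_iff_of_ne_lo_hi {i : Fin (n - 1)} {j : Fin n} (h : j ≠ lo i) :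
    lo i ≤ j ↔ hi i ≤ j := by
  simp only [Ne, Fin.ext_iff, Fin.le_def, lo, hi] at *
  omega

theorem simpleSwap_mul_self (i : Fin (n - 1)) : simpleSwap i * simpleSwap i = 1 :=
  Equiv.swap_mul_self _ _

/-- An adjacent transposition has a single inversion. -/
theorem eq_lo_hi_of_simpleSwap_lt {i : Fin (n - 1)} {x y : Fin n} (hxy : x < y)
    (h : simpleSwap i y < simpleSwap i x) : x = lo i ∧ y = hi i := by
  simp only [simpleSwap, Equiv.swap_apply_def, lo, hi, Fin.ext_iff, Fin.lt_def] at *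
  split_ifs at h <;> simp at * <;> omega

/-- The exchange property. -/
theorem exists_shorter_of_descent (L : List (Fin (n - 1))) (i : Fin (n - 1))
    (h : (L.map simpleSwap).prod (hi i) < (L.map simpleSwap).prod (lo i)) :
    ∃ L' : List (Fin (n - 1)), L'.length + 1 = L.length ∧
      (L'.map simpleSwap).prod = (L.map simpleSwap).prod * simpleSwap i := by
  induction L with
  | nil => exact absurd h (not_lt.2 (lo_lt_hi i).le)
  | cons k T ih =>
    rcases lt_trichotomy ((T.map simpleSwap).prod (hi i)) ((T.map simpleSwap).prod (lo i))
      with hT | hT | hT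
    · obtain ⟨T', hl, hp⟩ := ih hT
      exact ⟨k :: T', by simp [hl], by simp [hp, mul_assoc]⟩
    · exact absurd ((Equiv.injective _ hT).symm) (lo_ne_hi i)
    · simp only [List.map_cons, List.prod_cons, Equiv.Perm.mul_apply] at h
      -- Here the letter `k` creates the descent, so the product of `T` carries `lo i`, `hi i` to
      -- `lo k`, `hi k`. Hence `s_k` times this product equals the product times `s_i`, and deleting
      -- `k` gives the shorter word.
      obtain ⟨h1, h2⟩ := eq_lo_hi_of_simpleSwap_lt hT h
      refine ⟨T, rfl, ?_⟩
      have h3 : (T.map simpleSwap).prod * simpleSwap i =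
          simpleSwap k * (T.map simpleSwap).prod := by
        rw [simpleSwap, Equiv.mul_swap_eq_swap_mul, h1, h2, simpleSwap]
      rw [List.map_cons, List.prod_cons, mul_assoc, h3, ← mul_assoc, simpleSwap_mul_self, one_mul]

theorem coxeter_eq_prod_map (β : PositiveWord n l) :
    coxeter β = ((List.ofFn β).map simpleSwap).prod := by
  rw [List.map_ofFn]
  rfl

theorem exists_word_of_list (L : List (Fin (n - 1))) :
    ∃ γ : PositiveWord n L.length, coxeter γ = (L.map simpleSwap).prod :=
  ⟨L.get, by rw [coxeter_eq_prod_map, List.ofFn_get]⟩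

theorem coxeter_succ (β : PositiveWord n (l + 1)) :
    coxeter β = coxeter (fun k => β k.castSucc) * simpleSwap (β (Fin.last l)) := by
  rw [coxeter, List.ofFn_succ', List.concat_eq_append, List.prod_append, List.prod_singleton]
  rfl

theorem wordGL_succ (β : PositiveWord n (l + 1)) (z : Fin (l + 1) → ℂ) :
    wordGL β z = wordGL (fun k => β k.castSucc) (fun k => z k.castSucc) *
      braidGL (β (Fin.last l)) (z (Fin.last l)) := by
  rw [wordGL, List.ofFn_succ', List.concat_eq_append, List.prod_append, List.prod_singleton]
  rfl

theorem IsReducedWord.init {β : PositiveWord n (l + 1)} (h : IsReducedWord β) :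
    IsReducedWord fun k => β k.castSucc := by
  intro m γ hγ
  have h1 := h (m + 1) (Fin.snoc γ (β (Fin.last l)))
    (by simp [coxeter_succ, ← hγ])
  omega

/-- A descent would, by the exchange property, produce a word shorter than `β` with the same
projection. -/
theorem IsReducedWord.ascent {β : PositiveWord n (l + 1)} (h : IsReducedWord β) :
    coxeter (fun k => β k.castSucc) (lo (β (Fin.last l))) <
      coxeter (fun k => β k.castSucc) (hi (β (Fin.last l))) := by
  refine lt_of_le_of_ne (not_lt.1 fun hlt => ?_) fun heq => lo_ne_hi _ (Equiv.injective _ heq)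
  rw [coxeter_eq_prod_map] at hlt
  obtain ⟨L', hl, hp⟩ := exists_shorter_of_descent _ _ hlt
  obtain ⟨γ, hγ⟩ := exists_word_of_list L'
  have h1 := h _ γ (by rw [hγ, hp, coxeter_succ, coxeter_eq_prod_map fun k => β k.castSucc])
  rw [List.length_ofFn] at hl
  omega

theorem exists_word (w : Equiv.Perm (Fin n)) :
    ∃ (l : ℕ) (β : PositiveWord n l), coxeter β = w := by
  have key : ∀ w : Equiv.Perm (Fin n), ∃ L : List (Fin (n - 1)), (L.map simpleSwap).prod = w := by
    cases n with
    | zero => exact fun w => ⟨[], Subsingleton.elim _ _⟩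
    | succ m =>
      intro w
      have hw : w ∈ Submonoid.closure
          (Set.range fun i : Fin m => Equiv.swap i.castSucc i.succ) := by
        rw [Equiv.Perm.mclosure_swap_castSucc_succ]
        trivial
      induction hw using Submonoid.closure_induction with
      | mem x hx =>
        obtain ⟨i, rfl⟩ := hx
        exact ⟨[i], by simp only [List.map_cons, List.map_nil, List.prod_singleton]; rfl⟩
      | one => exact ⟨[], rfl⟩
      | mul x y _ _ hx hy =>
        obtain ⟨L, rfl⟩ := hx
        obtain ⟨L', rfl⟩ := hy
        exact ⟨L ++ L', by simp⟩
  obtain ⟨L, rfl⟩ := key w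
  exact ⟨_, exists_word_of_list L⟩

theorem exists_isReducedWordOf (w : Equiv.Perm (Fin n)) :
    ∃ (l : ℕ) (β : PositiveWord n l), IsReducedWordOf β w := by
  classical
  have h := exists_word w
  obtain ⟨β, hβ⟩ := Nat.find_spec h
  exact ⟨_, β, fun m γ hγ => Nat.find_min' h ⟨γ, hγ.trans hβ⟩, hβ⟩

/-! ### The matrices of reduced words -/

theorem braidGL_mul_apply (i : Fin (n - 1)) (z : ℂ) (A : GL (Fin n) ℂ) (r c : Fin n) :
    (braidGL i z * A).1 r c =
      if r = lo i then A.1 (hi i) c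
      else if r = hi i then A.1 (lo i) c + z * A.1 (hi i) c
      else A.1 r c := by
  have hne := lo_ne_hi i
  have key : ∀ k, braidMatrix i z r k =
      if r = lo i then (if k = hi i then 1 else 0)
      else if r = hi i then (if k = lo i then 1 else 0) + (if k = hi i then z else 0)
      else (if k = r then 1 else 0) := by
    intro k
    simp only [braidMatrix, Matrix.of_apply]
    grind
  change (braidMatrix i z * A.1) r c = _
  rw [Matrix.mul_apply]
  simp only [key]
  by_cases h1 : r = lo i
  · simp [h1]
  · by_cases h2 : r = hi i
    · simp [h2, hne.symm, add_mul, Finset.sum_add_distrib]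
    · simp [h1, h2]

theorem braidGL_inv_mul_apply (i : Fin (n - 1)) (z : ℂ) (A : GL (Fin n) ℂ) (r c : Fin n) :
    ((braidGL i z)⁻¹ * A).1 r c =
      if r = lo i then A.1 (hi i) c - z * A.1 (lo i) c
      else if r = hi i then A.1 (lo i) c
      else A.1 r c := by
  have hne := lo_ne_hi i
  have h := braidGL_mul_apply i z ((braidGL i z)⁻¹ * A)
  simp only [mul_inv_cancel_left] at h
  have h1 := h (lo i) c
  have h2 := h (hi i) c
  have h3 := h r c
  simp only [hne.symm, if_true, if_false] at h1 h2 h3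
  split_ifs with hr hr'
  · subst hr
    rw [h1, h2]
    ring
  · rw [h1, hr']
  · rw [h3, if_neg hr, if_neg hr']

theorem wordGL_inv_succ (β : PositiveWord n (l + 1)) (z : Fin (l + 1) → ℂ) :
    (wordGL β z)⁻¹ = (braidGL (β (Fin.last l)) (z (Fin.last l)))⁻¹ *
      (wordGL (fun k => β k.castSucc) (fun k => z k.castSucc))⁻¹ := by
  rw [wordGL_succ, mul_inv_rev]

theorem simpleSwap_lo (i : Fin (n - 1)) : simpleSwap i (lo i) = hi i := Equiv.swap_apply_left _ _

theorem simpleSwap_hi (i : Fin (n - 1)) : simpleSwap i (hi i) = lo i := Equiv.swap_apply_right _ _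

theorem simpleSwap_of_ne {i : Fin (n - 1)} {j : Fin n} (h : j ≠ lo i) (h' : j ≠ hi i) :
    simpleSwap i j = j := Equiv.swap_apply_of_ne_of_ne h h'

/-- For a reduced word, `B_β(z)⁻¹ = U w⁻¹` where both `U` and `(w U w⁻¹)ᵀ` are upper
unitriangular. -/
theorem wordGL_inv_apply {β : PositiveWord n l} (hβ : IsReducedWord β) (z : Fin l → ℂ) :
    (∀ r, ((wordGL β z)⁻¹).1 r (coxeter β r) = 1) ∧
    ∀ r c, ((wordGL β z)⁻¹).1 r (coxeter β c) ≠ 0 → r ≤ c ∧ coxeter β c ≤ coxeter β r := by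
  induction l with
  | zero =>
    have h : (wordGL β z)⁻¹ = 1 := by simp [wordGL]
    have h' : coxeter β = 1 := by simp [coxeter]
    rw [h, h']
    refine ⟨fun r => by simp, fun r c hrc => ?_⟩
    have : r = c := by
      by_contra hne
      exact hrc (by simp [hne])
    simp [this]
  | succ l ih =>
    obtain ⟨ih1, ih2⟩ := ih hβ.init (fun k => z k.castSucc)
    have hasc := hβ.ascent
    have hlt := lo_lt_hi (β (Fin.last l))
    rw [wordGL_inv_succ, coxeter_succ]
    generalize (wordGL (fun k => β k.castSucc) (fun k => z k.castSucc))⁻¹ = A at *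
    generalize coxeter (fun k => β k.castSucc) = w at *
    generalize β (Fin.last l) = i at *
    generalize z (Fin.last l) = t at *
    -- The ascent puts this entry outside the support allowed by induction, so `t` does not disturb
    -- the ones.
    have hzero : A.1 (lo i) (w (hi i)) = 0 := by
      by_contra h
      exact absurd (ih2 _ _ h).2 (not_le.2 hasc)
    constructor
    · intro r
      rw [braidGL_inv_mul_apply, Equiv.Perm.mul_apply]
      split_ifs with h h'
      · rw [h, simpleSwap_lo, ih1, hzero, mul_zero, sub_zero]
      · rw [h', simpleSwap_hi, ih1]
      · rw [simpleSwap_of_ne h h', ih1]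
    · intro r c hrc
      rw [braidGL_inv_mul_apply] at hrc
      simp only [Equiv.Perm.mul_apply] at hrc ⊢
      have hle : ∀ c, lo i ≤ simpleSwap i c → lo i ≤ c := by
        intro c hc
        by_cases h1 : c = lo i
        · exact h1.ge
        · by_cases h2 : c = hi i
          · exact h2 ▸ hlt.le
          · rwa [simpleSwap_of_ne h1 h2] at hc
      split_ifs at hrc with h h'
      · rw [h, simpleSwap_lo]
        -- The new row is row `hi i` minus `t` times row `lo i`; at least one of the two contributes
        -- a non-zero entry.
        by_cases h0 : A.1 (lo i) (w (simpleSwap i c)) = 0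
        · rw [h0, mul_zero, sub_zero] at hrc
          obtain ⟨h3, h4⟩ := ih2 _ _ hrc
          exact ⟨hle c (hlt.le.trans h3), h4⟩
        · obtain ⟨h3, h4⟩ := ih2 _ _ h0
          exact ⟨hle c h3, h4.trans hasc.le⟩
      · rw [h', simpleSwap_hi]
        obtain ⟨h3, h4⟩ := ih2 _ _ hrc
        refine ⟨?_, h4⟩
        rw [← le_iff_of_ne_lo_hi]
        · exact hle c h3
        -- With `c = lo i` the swap would give `w (hi i) ≤ w (lo i)`, against the ascent.
        · rintro rfl
          rw [simpleSwap_lo] at h4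
          exact absurd h4 (not_le.2 hasc)
      · rw [simpleSwap_of_ne h h']
        obtain ⟨h3, h4⟩ := ih2 _ _ hrc
        refine ⟨?_, h4⟩
        by_cases h1 : c = lo i
        · rw [h1, simpleSwap_lo] at h3
          rw [h1]
          refine not_lt.1 fun h5 => ?_
          exact h' (le_antisymm h3 ((le_iff_of_ne_lo_hi h).1 h5.le))
        · by_cases h2 : c = hi i
          · rw [h2, simpleSwap_hi] at h3
            exact h2 ▸ h3.trans hlt.le
          · rwa [simpleSwap_of_ne h1 h2] at h3

/-- The parameters of a reduced word are polynomials in the entries of `B_β(z)⁻¹`. -/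
theorem exists_polynomial_parameter {β : PositiveWord n l} (hβ : IsReducedWord β) (k : Fin l) :
    ∃ p : MvPolynomial (Fin n × Fin n) ℂ, ∀ z : Fin l → ℂ,
      MvPolynomial.eval (fun q => ((wordGL β z)⁻¹).1 q.1 q.2) p = z k := by
  induction l with
  | zero => exact k.elim0
  | succ l ih =>
    have hasc := hβ.ascent
    have hlt := lo_lt_hi (β (Fin.last l))
    obtain ⟨p₀, hp₀⟩ : ∃ p : MvPolynomial (Fin n × Fin n) ℂ, ∀ z : Fin (l + 1) → ℂ,
        MvPolynomial.eval (fun q => ((wordGL β z)⁻¹).1 q.1 q.2) p = z (Fin.last l) := by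
      -- With `w` the projection of the truncated word and `A` its inverse matrix, this entry is `A
      -- (hi, w lo) - z * A (lo, w lo)`. The first term vanishes by triangularity and the second
      -- coefficient is one.
      refine ⟨-MvPolynomial.X (lo (β (Fin.last l)),
        coxeter (fun k => β k.castSucc) (lo (β (Fin.last l)))), fun z => ?_⟩
      obtain ⟨h1, h2⟩ := wordGL_inv_apply hβ.init fun k => z k.castSucc
      have h3 : ((wordGL (fun k => β k.castSucc) fun k => z k.castSucc)⁻¹).1
          (hi (β (Fin.last l))) (coxeter (fun k => β k.castSucc) (lo (β (Fin.last l)))) = 0 := by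
        by_contra h
        exact absurd (h2 _ _ h).1 (not_le.2 hlt)
      simp only [map_neg, MvPolynomial.eval_X]
      rw [wordGL_inv_succ, braidGL_inv_mul_apply, if_pos rfl, h1, h3]
      ring
    induction k using Fin.lastCases with
    | last => exact ⟨p₀, hp₀⟩
    | cast k =>
      obtain ⟨p, hp⟩ := ih hβ.init k
      let i := β (Fin.last l)
      -- Multiplying by the last braid matrix, with `p₀` in place of its parameter, recovers the
      -- inverse matrix of the truncated word.
      let Q : Fin n × Fin n → MvPolynomial (Fin n × Fin n) ℂ := fun q =>
        if q.1 = lo i then MvPolynomial.X (hi i, q.2)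
        else if q.1 = hi i then
          MvPolynomial.X (lo i, q.2) + p₀ * MvPolynomial.X (hi i, q.2)
        else MvPolynomial.X q
      refine ⟨MvPolynomial.bind₁ Q p, fun z => ?_⟩
      rw [← hp fun k => z k.castSucc, ← MvPolynomial.coe_aeval_eq_eval, RingHom.coe_coe,
        MvPolynomial.aeval_bind₁, ← MvPolynomial.coe_aeval_eq_eval, RingHom.coe_coe]
      congr 2
      funext q
      have h : (wordGL (fun k => β k.castSucc) fun k => z k.castSucc)⁻¹ =
          braidGL i (z (Fin.last l)) * (wordGL β z)⁻¹ := by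
        rw [wordGL_inv_succ, mul_inv_cancel_left]
      rw [h, braidGL_mul_apply, ← hp₀ z, ← MvPolynomial.coe_aeval_eq_eval, RingHom.coe_coe]
      simp only [Q]
      split_ifs <;> simp


/-! ### Schubert cells -/

theorem finrank_inf_flagOf_mul (P : Submodule ℂ (Fin n → ℂ)) (g A : GL (Fin n) ℂ)
    (q : Fin (n + 1)) :
    Module.finrank ℂ (P ⊓ (flagOf (g * A)).space q : Submodule ℂ _) =
      Module.finrank ℂ (P.comap (glEquiv g).toLinearMap ⊓ (flagOf A).space q : Submodule ℂ _) := by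
  rw [flagOf_mul_space, ← (glEquiv g).finrank_map_eq (P.comap (glEquiv g).toLinearMap ⊓ _),
    Submodule.map_inf _ (glEquiv g).injective,
    Submodule.map_comap_eq_of_surjective (glEquiv g).surjective]

theorem finrank_stdSpace (p : Fin (n + 1)) : Module.finrank ℂ (stdSpace n p) = p := by
  rw [← flagOf_one_space]
  exact (flagOf 1).finrank_space p

theorem stdSpace_mono {p q : Fin (n + 1)} (h : p ≤ q) : stdSpace n p ≤ stdSpace n q :=
  fun _ hv => mem_stdSpace.2 fun j hj => mem_stdSpace.1 hv j ((Fin.le_def.1 h).trans hj)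

theorem braidGL_mulVec (i : Fin (n - 1)) (z : ℂ) (v : Fin n → ℂ) (r : Fin n) :
    glEquiv (braidGL i z) v r =
      if r = lo i then v (hi i) else if r = hi i then v (lo i) + z * v (hi i) else v r := by
  have h : ∀ c, (braidGL i z).1 r c = if r = lo i then (1 : Matrix (Fin n) (Fin n) ℂ) (hi i) c
      else if r = hi i then (1 : Matrix (Fin n) (Fin n) ℂ) (lo i) c +
        z * (1 : Matrix (Fin n) (Fin n) ℂ) (hi i) c
      else (1 : Matrix (Fin n) (Fin n) ℂ) r c := fun c => by
    simpa using braidGL_mul_apply i z 1 r c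
  rw [glEquiv_apply, Matrix.mulVec, dotProduct]
  simp only [h]
  split_ifs
  · simp [Matrix.one_apply]
  · simp [Matrix.one_apply, add_mul, Finset.sum_add_distrib]
  · simp [Matrix.one_apply]

/-- A braid matrix mixes only two adjacent coordinates, so it can move only the standard space that
separates them. -/
theorem comap_braidGL_stdSpace_of_ne (i : Fin (n - 1)) (z : ℂ) {p : Fin (n + 1)}
    (hp : p ≠ (lo i).succ) :
    (stdSpace n p).comap (glEquiv (braidGL i z)).toLinearMap = stdSpace n p := by
  have hp' : (p : ℕ) ≠ i + 1 := fun h => hp (Fin.ext h)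
  ext v
  simp only [Submodule.mem_comap, LinearEquiv.coe_coe, mem_stdSpace, braidGL_mulVec]
  constructor
  · intro h j hj
    by_cases h1 : j = lo i
    · have h2 := h (lo i) (h1 ▸ hj)
      have h3 := h (hi i) ((h1 ▸ hj).trans (lo_lt_hi i).le)
      rw [if_pos rfl] at h2
      rw [if_neg (lo_ne_hi i).symm, if_pos rfl, h2, mul_zero, add_zero] at h3
      rw [h1, h3]
    · by_cases h2 : j = hi i
      · have h3 : (p : ℕ) ≤ lo i := by
          rw [h2] at hj
          simp only [hi, lo] at *
          omega
        have h4 := h (lo i) h3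
        rw [if_pos rfl] at h4
        rw [h2, h4]
      · simpa [h1, h2] using h j hj
  · intro h j hj
    split_ifs with h1 h2
    · exact h _ ((h1 ▸ hj).trans (lo_lt_hi i).le)
    · have h3 : (p : ℕ) ≤ lo i := by
        rw [h2] at hj
        simp only [hi, lo] at *
        omega
      rw [h _ h3, h _ (h2 ▸ hj), mul_zero, add_zero]
    · exact h j hj

/-- As `z` varies, these preimages run through the hyperplanes of the next larger standard space
that contain the next smaller one, apart from the standard one itself. -/
theorem mem_comap_braidGL_stdSpace (i : Fin (n - 1)) (z : ℂ) (v : Fin n → ℂ) :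
    v ∈ (stdSpace n (lo i).succ).comap (glEquiv (braidGL i z)).toLinearMap ↔
      v ∈ stdSpace n (hi i).succ ∧ v (lo i) + z * v (hi i) = 0 := by
  simp only [Submodule.mem_comap, LinearEquiv.coe_coe, mem_stdSpace, braidGL_mulVec]
  constructor
  · intro h
    constructor
    · intro j hj
      have h1 : lo i < j := (lo_lt_hi i).trans (Fin.lt_def.2 hj)
      have h2 := h j (Fin.lt_def.1 h1)
      rwa [if_neg h1.ne', if_neg (Fin.lt_def.2 hj : hi i < j).ne'] at h2
    · have h2 := h (hi i) (Fin.lt_def.1 (lo_lt_hi i))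
      rwa [if_neg (lo_ne_hi i).symm, if_pos rfl] at h2
  · rintro ⟨h, h'⟩ j hj
    have h1 : lo i < j := Fin.lt_def.2 hj
    rw [if_neg h1.ne']
    split_ifs with h2
    · exact h'
    · refine h j (Fin.lt_def.1 (lt_of_le_of_ne ?_ (Ne.symm h2) : hi i < j))
      exact (le_iff_of_ne_lo_hi h1.ne').1 h1.le

/-- The number of `i ≤ p` with `w(i) ≤ q` (with one-based `i` and `w(i)`). -/
def cellRank (w : Equiv.Perm (Fin n)) (p q : Fin (n + 1)) : ℕ :=
  (Finset.univ.filter fun i : Fin n => (i : ℕ) < p ∧ (w i : ℕ) < q).card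

theorem mem_schubertCell_iff {w : Equiv.Perm (Fin n)} {F : CompleteFlag n} :
    F ∈ schubertCell w ↔ ∀ p q,
      Module.finrank ℂ (stdSpace n p ⊓ F.space q : Submodule ℂ _) = cellRank w p q := Iff.rfl

theorem cellRank_succ (w : Equiv.Perm (Fin n)) (p : Fin n) (q : Fin (n + 1)) :
    cellRank w p.succ q = cellRank w p.castSucc q + if (w p : ℕ) < q then 1 else 0 := by
  unfold cellRank
  split_ifs with h
  · rw [← Finset.card_insert_of_notMem (a := p) (by simp)]
    congr 1
    ext j
    simp only [Finset.mem_filter, Finset.mem_univ, true_and, Finset.mem_insert, Fin.val_succ,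
      Fin.val_castSucc]
    by_cases hj : j = p
    · simp [hj, h]
    · have : (j : ℕ) ≠ p := fun h => hj (Fin.ext h)
      simp only [hj, false_or]
      exact and_congr_left fun _ => by omega
  · rw [add_zero]
    congr 1
    ext j
    simp only [Finset.mem_filter, Finset.mem_univ, true_and, Fin.val_succ, Fin.val_castSucc]
    by_cases hj : j = p
    · simp [hj, h]
    · have : (j : ℕ) ≠ p := fun h => hj (Fin.ext h)
      exact and_congr_left fun _ => by omega

theorem cellRank_mul_simpleSwap (w : Equiv.Perm (Fin n)) {i : Fin (n - 1)} {p : Fin (n + 1)}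
    (hp : p ≠ (lo i).succ) (q : Fin (n + 1)) :
    cellRank (w * simpleSwap i) p q = cellRank w p q := by
  have hp' : (p : ℕ) ≠ i + 1 := fun h => hp (Fin.ext h)
  have hlt : ∀ j, ((simpleSwap i j : Fin n) : ℕ) < p ↔ (j : ℕ) < p := by
    intro j
    simp only [simpleSwap, Equiv.swap_apply_def]
    split_ifs with h h
    · rw [h]
      simp only [lo, hi]
      omega
    · rw [h]
      simp only [lo, hi]
      omega
    · rfl
  unfold cellRank
  refine Finset.card_equiv (simpleSwap i) fun j => ?_
  rw [Finset.mem_filter, Finset.mem_filter]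
  simp [hlt]

/-- Submodularity of dimension. It is applied to two distinct members `S`, `S'` of the pencil of
spaces between `E` and `G`. -/
theorem finrank_inf_add_finrank_inf_le {S S' E G : Submodule ℂ (Fin n → ℂ)} (hS : S ≤ G)
    (hS' : S' ≤ G) (hE : S ⊓ S' ≤ E) (X : Submodule ℂ (Fin n → ℂ)) :
    Module.finrank ℂ (S ⊓ X : Submodule ℂ _) + Module.finrank ℂ (S' ⊓ X : Submodule ℂ _) ≤
      Module.finrank ℂ (G ⊓ X : Submodule ℂ _) + Module.finrank ℂ (E ⊓ X : Submodule ℂ _) := by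
  rw [← Submodule.finrank_sup_add_finrank_inf_eq]
  refine add_le_add (Submodule.finrank_mono ?_) (Submodule.finrank_mono ?_)
  · exact sup_le (inf_le_inf_right X hS) (inf_le_inf_right X hS')
  · exact le_inf ((inf_le_inf inf_le_left inf_le_left).trans hE) (inf_le_left.trans inf_le_right)

theorem finrank_stdSpace_succ_inf_le (p : Fin n) (X : Submodule ℂ (Fin n → ℂ)) :
    Module.finrank ℂ (stdSpace n p.succ ⊓ X : Submodule ℂ _) ≤
      Module.finrank ℂ (stdSpace n p.castSucc ⊓ X : Submodule ℂ _) + 1 := by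
  have h := Submodule.finrank_sup_add_finrank_inf_eq (stdSpace n p.castSucc)
    (stdSpace n p.succ ⊓ X)
  have hle : stdSpace n p.castSucc ≤ stdSpace n p.succ :=
    stdSpace_mono (Fin.castSucc_lt_succ (i := p)).le
  have h1 : Module.finrank ℂ
      (stdSpace n p.castSucc ⊔ (stdSpace n p.succ ⊓ X) : Submodule ℂ _) ≤ p + 1 :=
    (Submodule.finrank_mono (sup_le hle inf_le_left)).trans (finrank_stdSpace p.succ).le
  rw [← inf_assoc, inf_eq_left.2 hle, finrank_stdSpace, Fin.val_castSucc] at h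
  omega

/-- Left multiplication by braid matrices relates the Schubert cells of `w` and `w s_i`. -/
theorem flagOf_mem_schubertCell_mul_simpleSwap {w : Equiv.Perm (Fin n)} {i : Fin (n - 1)}
    (hw : w (lo i) < w (hi i)) (A : GL (Fin n) ℂ) :
    flagOf A ∈ schubertCell (w * simpleSwap i) ↔
      ∃ z, flagOf (braidGL i z * A) ∈ schubertCell w := by
  have hhi : (hi i).castSucc = (lo i).succ := Fin.ext rfl
  have hne : (lo i).castSucc ≠ (lo i).succ := (Fin.castSucc_lt_succ (i := lo i)).ne
  have hne' : (hi i).succ ≠ (lo i).succ := by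
    rw [← hhi]
    exact (Fin.castSucc_lt_succ (i := hi i)).ne'
  have hES : stdSpace n (lo i).castSucc ≤ stdSpace n (lo i).succ :=
    stdSpace_mono (Fin.castSucc_lt_succ (i := lo i)).le
  have hSG : stdSpace n (lo i).succ ≤ stdSpace n (hi i).succ :=
    hhi ▸ stdSpace_mono (Fin.castSucc_lt_succ (i := hi i)).le
  have hS' : ∀ z, (stdSpace n (lo i).succ).comap (glEquiv (braidGL i z)).toLinearMap ≤
      stdSpace n (hi i).succ := fun z v hv => ((mem_comap_braidGL_stdSpace i z v).1 hv).1
  have hE : ∀ z, stdSpace n (lo i).succ ⊓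
      (stdSpace n (lo i).succ).comap (glEquiv (braidGL i z)).toLinearMap ≤
        stdSpace n (lo i).castSucc := by
    rintro z v ⟨h1, h2⟩
    have h3 := ((mem_comap_braidGL_stdSpace i z v).1 h2).2
    have h4 := mem_stdSpace.1 h1
    rw [h4 (hi i) le_rfl, mul_zero, add_zero] at h3
    refine mem_stdSpace.2 fun j hj => ?_
    by_cases hj' : j = lo i
    · rw [hj', h3]
    · exact h4 j ((le_iff_of_ne_lo_hi hj').1 hj)
  have hES' : ∀ z, stdSpace n (lo i).castSucc ≤
      (stdSpace n (lo i).succ).comap (glEquiv (braidGL i z)).toLinearMap := by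
    intro z
    rw [← comap_braidGL_stdSpace_of_ne i z hne]
    exact Submodule.comap_mono hES
  have hN : ∀ q, cellRank (w * simpleSwap i) (lo i).succ q = cellRank w (lo i).castSucc q +
      if (w (hi i) : ℕ) < q then 1 else 0 := by
    intro q
    rw [cellRank_succ, cellRank_mul_simpleSwap w hne, Equiv.Perm.mul_apply, simpleSwap_lo]
  have hG : ∀ q, cellRank w (hi i).succ q = cellRank w (lo i).castSucc q +
      (if (w (lo i) : ℕ) < q then 1 else 0) + if (w (hi i) : ℕ) < q then 1 else 0 := by
    intro q
    rw [cellRank_succ, hhi, cellRank_succ]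
  have hw' : (w (lo i) : ℕ) < w (hi i) := hw
  simp only [mem_schubertCell_iff, finrank_inf_flagOf_mul]
  constructor
  · intro h
    -- For a flag in the cell of `w * simpleSwap i`, this is the first index at which its space
    -- meets the larger standard space outside the middle one. A vector `v` witnessing this
    -- determines the member of the pencil to use.
    let q₀ : Fin (n + 1) := (w (lo i)).succ
    obtain ⟨v, ⟨hvG, hvX⟩, hvS⟩ : ∃ v, v ∈ stdSpace n (hi i).succ ⊓ (flagOf A).space q₀ ∧
        v ∉ stdSpace n (lo i).succ := by
      by_contra! hall
      have h1 := Submodule.finrank_mono (le_inf hall inf_le_right)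
      rw [h, h, cellRank_mul_simpleSwap w hne', hG, hN] at h1
      have h2 : (w (lo i) : ℕ) < q₀ := by simp [q₀]
      have h3 : ¬ (w (hi i) : ℕ) < q₀ := by
        simp only [q₀, Fin.val_succ]
        omega
      rw [if_pos h2, if_neg h3] at h1
      omega
    have hv0 : v (hi i) ≠ 0 := by
      intro h0
      apply hvS
      refine mem_stdSpace.2 fun j hj => ?_
      by_cases hj' : j = hi i
      · rw [hj', h0]
      · refine mem_stdSpace.1 hvG j ?_
        have h1 : hi i ≤ j := hj
        exact Fin.lt_def.1 (lt_of_le_of_ne h1 (Ne.symm hj'))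
    -- The solution of `v (lo i) + z * v (hi i) = 0`, which places `v` in the moved space.
    refine ⟨-(v (lo i) / v (hi i)), fun p q => ?_⟩
    generalize hz : -(v (lo i) / v (hi i)) = z
    by_cases hp : p = (lo i).succ
    · subst hp
      have hvS' : v ∈ (stdSpace n (lo i).succ).comap (glEquiv (braidGL i z)).toLinearMap := by
        refine (mem_comap_braidGL_stdSpace i z v).2 ⟨hvG, ?_⟩
        rw [← hz]
        field_simp
        ring
      -- Submodularity bounds the dimension from above; the vector `v`, which lies in the flag's
      -- space once `w (lo i) < q`, gives the matching lower bound.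
      have h1 := finrank_inf_add_finrank_inf_le hSG (hS' z) (hE z) ((flagOf A).space q)
      rw [h, h, h, cellRank_mul_simpleSwap w hne', cellRank_mul_simpleSwap w hne, hN, hG] at h1
      have h2 := Submodule.finrank_mono (inf_le_inf_right ((flagOf A).space q) (hES' z))
      rw [h, cellRank_mul_simpleSwap w hne] at h2
      rw [cellRank_succ]
      by_cases hq : (w (lo i) : ℕ) < q
      · have h3 : stdSpace n (lo i).castSucc ⊓ (flagOf A).space q <
            (stdSpace n (lo i).succ).comap (glEquiv (braidGL i z)).toLinearMap ⊓
              (flagOf A).space q := by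
          refine lt_of_le_of_ne (inf_le_inf_right _ (hES' z)) fun heq => hvS (hES ?_)
          have h4 : v ∈ (stdSpace n (lo i).succ).comap (glEquiv (braidGL i z)).toLinearMap ⊓
              (flagOf A).space q :=
            ⟨hvS', (flagOf A).monotone_space (Fin.le_def.2 (by simpa [q₀] using hq)) hvX⟩
          rw [← heq] at h4
          exact h4.1
        have h4 := Submodule.finrank_lt_finrank_of_lt h3
        rw [h, cellRank_mul_simpleSwap w hne] at h4
        rw [if_pos hq] at h1 ⊢
        omega
      · rw [if_neg hq] at h1 ⊢
        omega
    · rw [comap_braidGL_stdSpace_of_ne i z hp, h, cellRank_mul_simpleSwap w hp]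
  · rintro ⟨z, h⟩ p q
    have hE' := h (lo i).castSucc q
    rw [comap_braidGL_stdSpace_of_ne i z hne] at hE'
    have hG' := h (hi i).succ q
    rw [comap_braidGL_stdSpace_of_ne i z hne', hG] at hG'
    by_cases hp : p = (lo i).succ
    · subst hp
      have h1 := finrank_inf_add_finrank_inf_le hSG (hS' z) (hE z) ((flagOf A).space q)
      rw [h, hE', hG', cellRank_succ] at h1
      have h2 := Submodule.finrank_mono (inf_le_inf_right ((flagOf A).space q) hES)
      rw [hE'] at h2
      -- The lower bound: if `w (hi i) < q`, the ascent gives `w (lo i) < q` too. The larger space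
      -- then meets the flag in two dimensions more than the smaller one, and at most one of them is
      -- gained above the middle space.
      have h3 := finrank_stdSpace_succ_inf_le (hi i) ((flagOf A).space q)
      rw [hhi, hG'] at h3
      rw [hN]
      split_ifs at h1 h3 ⊢ <;> omega
    · rw [cellRank_mul_simpleSwap w hp, ← h, comap_braidGL_stdSpace_of_ne i z hp]

/-- The conditions with `p = q` already force each space to be the standard one. -/
theorem mem_schubertCell_one_iff {F : CompleteFlag n} :
    F ∈ schubertCell 1 ↔ F = flagOf 1 := by
  constructor
  · intro h
    refine CompleteFlag.ext_space fun k => ?_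
    have hk : cellRank (1 : Equiv.Perm (Fin n)) k k = k := by
      simp only [cellRank, Equiv.Perm.one_apply, and_self]
      rw [Fin.card_filter_val_lt]
      exact min_eq_right (by omega)
    have h1 := (mem_schubertCell_iff.1 h k k).trans hk
    rw [flagOf_one_space]
    exact (Submodule.eq_of_le_of_finrank_eq inf_le_right (h1.trans (F.finrank_space k).symm)).symm.trans
      (Submodule.eq_of_le_of_finrank_eq inf_le_left (h1.trans (finrank_stdSpace k).symm))
  · rintro rfl p q
    rw [flagOf_one_space]
    change _ = cellRank 1 p q
    have key : cellRank 1 p q = min (p : ℕ) q := by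
      simp only [cellRank, Equiv.Perm.one_apply, ← lt_min_iff]
      rw [Fin.card_filter_val_lt]
      exact min_eq_right (by omega)
    rw [key]
    rcases le_total p q with hpq | hpq
    · rw [inf_eq_left.2 (stdSpace_mono hpq), finrank_stdSpace, min_eq_left (Fin.le_def.1 hpq)]
    · rw [inf_eq_right.2 (stdSpace_mono hpq), finrank_stdSpace, min_eq_right (Fin.le_def.1 hpq)]

/-- A reduced word for `w` parametrizes the Schubert cell of `w`. -/
theorem flagOf_mem_schubertCell_iff {β : PositiveWord n l} (hβ : IsReducedWord β)
    (A : GL (Fin n) ℂ) :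
    flagOf A ∈ schubertCell (coxeter β) ↔ ∃ z, flagOf A = flagOf (wordGL β z)⁻¹ := by
  induction l generalizing A with
  | zero =>
    have h : ∀ z, (wordGL β z)⁻¹ = 1 := by simp [wordGL]
    have h' : coxeter β = 1 := by simp [coxeter]
    simp only [h, h', mem_schubertCell_one_iff, exists_const]
  | succ l ih =>
    rw [coxeter_succ, flagOf_mem_schubertCell_mul_simpleSwap hβ.ascent]
    simp only [ih hβ.init]
    constructor
    · rintro ⟨t, z, h⟩
      refine ⟨Fin.snoc z t, ?_⟩
      rw [wordGL_inv_succ, ← flagOf_mul_eq_iff (braidGL (β (Fin.last l)) t)]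
      simpa using h
    · rintro ⟨z, h⟩
      refine ⟨z (Fin.last l), fun k => z k.castSucc, ?_⟩
      rw [wordGL_inv_succ] at h
      rw [flagOf_mul_congr _ h, mul_inv_cancel_left]


/-! ### Permutation matrices and the longest element -/

theorem permMatrix_mul_apply (w : Equiv.Perm (Fin n)) (A : Matrix (Fin n) (Fin n) ℂ)
    (r c : Fin n) : (permMatrix w * A) r c = A (w⁻¹ r) c := by
  rw [Matrix.mul_apply, Finset.sum_eq_single (w⁻¹ r)]
  · simp [permMatrix]
  · intro k _ hk
    have : r ≠ w k := by
      rintro rfl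
      simp at hk
    simp [permMatrix, this]
  · simp

theorem permMatrix_mul_inv (w : Equiv.Perm (Fin n)) : permMatrix w * permMatrix w⁻¹ = 1 := by
  ext r c
  rw [permMatrix_mul_apply]
  simp [permMatrix, Matrix.one_apply]

/-- The matrix of a permutation as an element of `GL_n(ℂ)`. -/
def permGL (w : Equiv.Perm (Fin n)) : GL (Fin n) ℂ where
  val := permMatrix w
  inv := permMatrix w⁻¹
  val_inv := permMatrix_mul_inv w
  inv_val := mul_eq_one_comm.1 (permMatrix_mul_inv w)

theorem permGL_mul_apply (w : Equiv.Perm (Fin n)) (A : GL (Fin n) ℂ) (r c : Fin n) :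
    (permGL w * A).1 r c = A.1 (w⁻¹ r) c := permMatrix_mul_apply w A.1 r c

/-- On the translate by `g` of the cell of a reduced word, the parameters of the word extend to
regular functions on an open neighbourhood in the flag variety. -/
theorem exists_regular_parameter {β : PositiveWord n l} (hβ : IsReducedWord β) (g : GL (Fin n) ℂ) :
    ∃ (W : Set (CompleteFlag n)) (ζ : Fin l → CompleteFlag n → ℂ),
      IsOpen[(flagVariety n).zariski] W ∧ (∀ k, (flagVariety n).IsRegularOn (ζ k) W) ∧
      ∀ z, flagOf (g * (wordGL β z)⁻¹) ∈ W ∧ ∀ k, ζ k (flagOf (g * (wordGL β z)⁻¹)) = z k := by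
  -- Undoing `g` and multiplying by `w` turns the representative into `w B_β(z)⁻¹`, which is lower
  -- unitriangular.
  obtain ⟨W, s, hW, hs, hsec⟩ := exists_regular_section (permGL (coxeter β) * g⁻¹)
  choose p hp using exists_polynomial_parameter hβ
  have hmul : ∀ z, permGL (coxeter β) * g⁻¹ * (g * (wordGL β z)⁻¹) =
      permGL (coxeter β) * (wordGL β z)⁻¹ := fun z => by
    rw [mul_assoc, inv_mul_cancel_left]
  have hinv : ∀ r, coxeter β ((coxeter β)⁻¹ r) = r := fun r => by simp
  have hinv' : ∀ r, (coxeter β)⁻¹ (coxeter β r) = r := fun r => by simp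
  have hL : ∀ z, IsLowerUnitriangular
      (permGL (coxeter β) * g⁻¹ * (g * (wordGL β z)⁻¹)).1 := by
    intro z
    obtain ⟨h1, h2⟩ := wordGL_inv_apply hβ z
    rw [hmul]
    constructor
    · intro r c hrc
      rw [permGL_mul_apply]
      by_contra h
      have h3 := h2 ((coxeter β)⁻¹ r) ((coxeter β)⁻¹ c)
      rw [hinv, hinv] at h3
      exact absurd (h3 h).2 (not_le.2 hrc)
    · intro r
      rw [permGL_mul_apply]
      have h3 := h1 ((coxeter β)⁻¹ r)
      rwa [hinv] at h3
  have hs' : ∀ q : Fin n × Fin n, (flagVariety n).IsRegularOn (s (coxeter β q.1) q.2) W :=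
    fun q => hs (coxeter β q.1) q.2
  have hreg : ∀ k, (flagVariety n).IsRegularOn
      (fun F => MvPolynomial.eval (fun q => s (coxeter β q.1) q.2 F) (p k)) W := fun k =>
    (flagVariety n).isRegularOn_eval hs' (p k)
  refine ⟨W, _, hW, hreg, fun z => ?_⟩
  obtain ⟨h1, h2⟩ := hsec _ (hL z)
  refine ⟨h1, fun k => ?_⟩
  refine Eq.trans ?_ (hp k z)
  refine congrArg (fun f => MvPolynomial.eval f (p k)) (funext fun q => ?_)
  rw [h2, hmul, permGL_mul_apply, hinv']

/-! ### Conjugation by the longest element -/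

theorem w0_apply (j : Fin n) : w0 n j = j.rev := rfl

theorem w0_mul_self : w0 n * w0 n = 1 := by
  ext j
  simp [w0]

theorem w0_inv : (w0 n)⁻¹ = w0 n := inv_eq_of_mul_eq_one_left w0_mul_self

theorem permGL_w0_mul_self : permGL (w0 n) * permGL (w0 n) = 1 := by
  refine Units.ext ?_
  ext r c
  rw [permGL_mul_apply, w0_inv]
  simp [permGL, permMatrix, w0, Matrix.one_apply]

theorem lo_rev (i : Fin (n - 1)) : lo i.rev = (hi i).rev := by
  ext
  simp only [lo, hi, Fin.val_rev]
  omega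

theorem hi_rev (i : Fin (n - 1)) : hi i.rev = (lo i).rev := by
  ext
  simp only [lo, hi, Fin.val_rev]
  omega

/-- Conjugation by `w₀` reflects the block to the opposite position and moves `z` to its other
diagonal corner, where the inverse of a braid matrix carries the negated parameter. -/
theorem permGL_w0_mul_braidGL (i : Fin (n - 1)) (z : ℂ) :
    permGL (w0 n) * braidGL i z = (braidGL i.rev (-z))⁻¹ * permGL (w0 n) := by
  refine Units.ext ?_
  ext r c
  have h : ∀ r c, (permGL (w0 n)).1 r c = if r.rev = c then 1 else 0 := by
    intro r c
    have := permGL_mul_apply (w0 n) 1 r c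
    rwa [mul_one, w0_inv, w0_apply, Units.val_one, Matrix.one_apply] at this
  have h' := braidGL_mul_apply i z 1 r.rev c
  simp only [mul_one, Units.val_one, Matrix.one_apply] at h'
  rw [permGL_mul_apply, w0_inv, w0_apply, h', braidGL_inv_mul_apply]
  simp only [h, lo_rev, hi_rev, Fin.rev_rev, Fin.rev_eq_iff (i := r)]
  have hne := lo_ne_hi i
  have hne' : (lo i).rev ≠ (hi i).rev := fun h => hne (Fin.rev_injective h)
  by_cases h1 : r = (lo i).rev
  · simp only [h1, hne', if_true, if_false]
  · by_cases h2 : r = (hi i).rev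
    · simp only [h2, hne'.symm, if_true, if_false]
      ring
    · simp only [h1, h2, if_false]

/-- The word of `w₀ w⁻¹ w₀`, for a word of `w`: reversed, and reflected. -/
def starWord (β : PositiveWord n l) : PositiveWord n l := fun k => (β k.rev).rev

theorem starWord_starWord (β : PositiveWord n l) : starWord (starWord β) = β := by
  funext k
  simp [starWord]

theorem coxeter_cons (β : PositiveWord n (l + 1)) :
    coxeter β = simpleSwap (β 0) * coxeter (fun k => β k.succ) := by
  rw [coxeter, List.ofFn_succ, List.prod_cons]
  rfl

theorem wordGL_cons (β : PositiveWord n (l + 1)) (z : Fin (l + 1) → ℂ) :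
    wordGL β z = braidGL (β 0) (z 0) * wordGL (fun k => β k.succ) (fun k => z k.succ) := by
  rw [wordGL, List.ofFn_succ, List.prod_cons]
  rfl

theorem starWord_zero (β : PositiveWord n (l + 1)) : starWord β 0 = (β (Fin.last l)).rev := by
  simp [starWord]

theorem starWord_tail (β : PositiveWord n (l + 1)) :
    (fun k : Fin l => starWord β k.succ) = starWord fun k => β k.castSucc := by
  funext k
  simp [starWord, Fin.rev_succ]

theorem w0_mul_coxeter (β : PositiveWord n l) :
    w0 n * coxeter β = (coxeter (starWord β))⁻¹ * w0 n := by
  induction l with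
  | zero => simp [coxeter]
  | succ l ih =>
    have h : w0 n * simpleSwap (β (Fin.last l)) =
        (simpleSwap (β (Fin.last l)).rev)⁻¹ * w0 n := by
      rw [simpleSwap, Equiv.mul_swap_eq_swap_mul, simpleSwap, Equiv.swap_inv, lo_rev, hi_rev,
        Equiv.swap_comm, w0_apply, w0_apply]
    rw [coxeter_succ, coxeter_cons (starWord β), starWord_tail, starWord_zero, ← mul_assoc, ih,
      mul_assoc, h, mul_inv_rev, mul_assoc]

theorem coxeter_starWord (β : PositiveWord n l) :
    coxeter (starWord β) = w0 n * (coxeter β)⁻¹ * w0 n := by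
  have h := w0_mul_coxeter β
  rw [← mul_inv_eq_iff_eq_mul, w0_inv] at h
  rw [← inv_inj, ← h, mul_inv_rev, mul_inv_rev, w0_inv, inv_inv, mul_assoc]

/-- `starWord` is a length-preserving involution whose effect on projections depends on the
projection alone, so a shorter word for one side would give one for the other. -/
theorem IsReducedWord.starWord {β : PositiveWord n l} (h : IsReducedWord β) :
    IsReducedWord (starWord β) := by
  intro m γ hγ
  refine h m (BraidRichardson.starWord γ) ?_
  rw [coxeter_starWord, hγ, ← coxeter_starWord, starWord_starWord]

theorem permGL_w0_mul_wordGL (β : PositiveWord n l) (z : Fin l → ℂ) :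
    permGL (w0 n) * wordGL β z = (wordGL (starWord β) fun k => -z k.rev)⁻¹ * permGL (w0 n) := by
  induction l with
  | zero => simp [wordGL]
  | succ l ih =>
    rw [wordGL_succ, wordGL_cons (starWord β), starWord_tail, starWord_zero, ← mul_assoc, ih,
      mul_assoc, permGL_w0_mul_braidGL, mul_inv_rev, mul_assoc]
    simp [Fin.rev_succ]

theorem wordGL_mul_permGL_w0 (β : PositiveWord n l) (z : Fin l → ℂ) :
    wordGL β z * permGL (w0 n) =
      permGL (w0 n) * (wordGL (starWord β) fun k => -z k.rev)⁻¹ := by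
  have h := congrArg (fun A => permGL (w0 n) * A * permGL (w0 n)) (permGL_w0_mul_wordGL β z)
  simp only [← mul_assoc, permGL_w0_mul_self, one_mul] at h
  rw [h, mul_assoc _ (permGL (w0 n)) (permGL (w0 n)), permGL_w0_mul_self, mul_one]

/-! ### Opposite Schubert cells -/

theorem flagOf_permGL_w0_space (q : Fin (n + 1)) :
    (flagOf (permGL (w0 n))).space q = antSpace n q := by
  simp only [flagOf, antSpace]
  congr 1
  ext i j
  simp [permGL, permMatrix, Pi.single_apply, w0]

theorem comap_permGL_w0_stdSpace (q : Fin (n + 1)) :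
    (stdSpace n q).comap (glEquiv (permGL (w0 n))).toLinearMap = antSpace n q := by
  rw [← flagOf_one_space, ← permGL_w0_mul_self, flagOf_mul_space, flagOf_permGL_w0_space]
  exact Submodule.comap_map_eq_of_injective (glEquiv (permGL (w0 n))).injective _

/-- Translation by `w₀` turns anti-standard spaces into standard ones. The two counts agree through
the bijection `u * w0 n`, with `p` and `q` exchanged. -/
theorem flagOf_mem_oppositeSchubertCell_iff (u : Equiv.Perm (Fin n)) (A : GL (Fin n) ℂ) :
    flagOf A ∈ oppositeSchubertCell u ↔
      flagOf (permGL (w0 n) * A) ∈ schubertCell (u * w0 n) := by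
  have hcard : ∀ p q : Fin (n + 1),
      (Finset.univ.filter fun i : Fin n => (i : ℕ) < p ∧ ((w0 n * u⁻¹) i : ℕ) < q).card =
        cellRank (u * w0 n) q p := by
    intro p q
    refine (Finset.card_equiv (u * w0 n) fun j => ?_).symm
    rw [Finset.mem_filter, Finset.mem_filter]
    have h : (w0 n * u⁻¹) ((u * w0 n) j) = j := by simp [w0]
    simp only [h, Finset.mem_univ, true_and]
    exact and_comm
  rw [mem_schubertCell_iff, forall_comm]
  refine forall_congr' fun p => forall_congr' fun q => ?_
  rw [finrank_inf_flagOf_mul, comap_permGL_w0_stdSpace, hcard, inf_comm]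

theorem flagOf_mem_oppositeSchubertCell_iff_exists {β : PositiveWord n l} (hβ : IsReducedWord β)
    (A : GL (Fin n) ℂ) :
    flagOf A ∈ oppositeSchubertCell (w0 n * (coxeter β)⁻¹) ↔
      ∃ z, flagOf A = flagOf (wordGL β z * permGL (w0 n)) := by
  rw [flagOf_mem_oppositeSchubertCell_iff, ← coxeter_starWord,
    flagOf_mem_schubertCell_iff hβ.starWord]
  have hiff : ∀ z, flagOf A = flagOf (wordGL β z * permGL (w0 n)) ↔
      flagOf (permGL (w0 n) * A) = flagOf (wordGL (starWord β) fun k => -z k.rev)⁻¹ := by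
    intro z
    rw [wordGL_mul_permGL_w0, ← flagOf_mul_eq_iff (permGL (w0 n)), ← mul_assoc,
      permGL_w0_mul_self, one_mul]
  simp only [hiff]
  constructor
  · rintro ⟨z, h⟩
    exact ⟨fun k => -z k.rev, by simpa using h⟩
  · rintro ⟨z, h⟩
    exact ⟨_, h⟩

/-! ### Braid varieties of concatenated words -/

variable {l₁ l₂ : ℕ}

theorem wordGL_append (β₁ : PositiveWord n l₁) (β₂ : PositiveWord n l₂) (z : Fin (l₁ + l₂) → ℂ) :
    wordGL (Fin.append β₁ β₂) z = wordGL β₁ (fun k => z (Fin.castAdd l₂ k)) *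
      wordGL β₂ (fun k => z (Fin.natAdd l₁ k)) := by
  rw [wordGL, List.ofFn_add, List.prod_append]
  congr 3
  · funext k
    exact congrArg (braidGL · _) (Fin.append_left β₁ β₂ k)
  · funext k
    exact congrArg (braidGL · _) (Fin.append_right β₁ β₂ k)

/-- Upper triangularity of `B₁ (B₂ w₀)` says that `B₂ w₀` and `B₁⁻¹` differ on the right by an upper
triangular matrix. -/
theorem mem_braidVariety_append_iff (β₁ : PositiveWord n l₁) (β₂ : PositiveWord n l₂)
    (z : Fin (l₁ + l₂) → ℂ) :
    z ∈ braidVariety (Fin.append β₁ β₂) (w0 n) ↔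
      flagOf (wordGL β₂ (fun k => z (Fin.natAdd l₁ k)) * permGL (w0 n)) =
        flagOf (wordGL β₁ fun k => z (Fin.castAdd l₂ k))⁻¹ := by
  rw [flagOf_eq_flagOf_iff, inv_inv, ← mul_assoc, ← wordGL_append]
  rfl

/-- The map from the braid variety to the flag variety. -/
def braidFlag (β₁ : PositiveWord n l₁) (l₂ : ℕ) (z : Fin (l₁ + l₂) → ℂ) : CompleteFlag n :=
  flagOf (wordGL β₁ fun k => z (Fin.castAdd l₂ k))⁻¹

theorem isRegularOn_wordGL_inv {X : Type*} (S : SpaceWithFunctions X) (β : PositiveWord n l)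
    {ζ : Fin l → X → ℂ} {U : Set X} (hζ : ∀ k, S.IsRegularOn (ζ k) U) (r c : Fin n) :
    S.IsRegularOn (fun x => ((wordGL β fun k => ζ k x)⁻¹).1 r c) U := by
  induction l generalizing r c with
  | zero =>
    have h : ∀ z, (wordGL β z)⁻¹ = 1 := by simp [wordGL]
    simpa only [h] using S.const' _ U
  | succ l ih =>
    have ih' := ih (fun k => β k.castSucc) fun k => hζ k.castSucc
    simp only [wordGL_inv_succ, braidGL_inv_mul_apply]
    split_ifs
    · simpa [sub_eq_add_neg] using S.add' (ih' (hi (β (Fin.last l))) c)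
        (S.mul' (S.const' (-1) U) (S.mul' (hζ (Fin.last l)) (ih' (lo (β (Fin.last l))) c)))
    · exact ih' _ _
    · exact ih' _ _

theorem isMorphism_braidFlag (β₁ : PositiveWord n l₁) (l₂ : ℕ) :
    (SpaceWithFunctions.affine (Fin (l₁ + l₂))).IsMorphism (flagVariety n)
      (braidFlag β₁ l₂) := by
  refine (SpaceWithFunctions.isMorphism_coinduced (generalLinearSpace n) flagOf).comp
    (φ := fun z : Fin (l₁ + l₂) → ℂ => (wordGL β₁ fun k => z (Fin.castAdd l₂ k))⁻¹)
    (SpaceWithFunctions.IsMorphism.to_induced (SpaceWithFunctions.isMorphism_affine _ ?_))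
  intro q
  exact isRegularOn_wordGL_inv _ β₁
    (fun k => SpaceWithFunctions.isRegularOn_coord (Fin.castAdd l₂ k) Set.univ) q.1 q.2

theorem bijOn_braidFlag {β₁ : PositiveWord n l₁} {β₂ : PositiveWord n l₂}
    (h₁ : IsReducedWord β₁) (h₂ : IsReducedWord β₂) :
    Set.BijOn (braidFlag β₁ l₂) (braidVariety (Fin.append β₁ β₂) (w0 n))
      (schubertCell (coxeter β₁) ∩ oppositeSchubertCell (w0 n * (coxeter β₂)⁻¹)) := by
  refine ⟨fun z hz => ⟨?_, ?_⟩, fun z hz z' hz' h => ?_, ?_⟩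
  · exact (flagOf_mem_schubertCell_iff h₁ _).2 ⟨_, rfl⟩
  · exact (flagOf_mem_oppositeSchubertCell_iff_exists h₂ _).2
      ⟨_, ((mem_braidVariety_append_iff β₁ β₂ z).1 hz).symm⟩
  -- Both groups of parameters are functions of the one flag: the first through `B₁⁻¹`, the second
  -- through `B₂ w₀` rewritten with the star word.
  · obtain ⟨_, ζ₁, -, -, hζ₁⟩ := exists_regular_parameter h₁ 1
    obtain ⟨_, ζ₂, -, -, hζ₂⟩ := exists_regular_parameter h₂.starWord (permGL (w0 n))
    have e := ((mem_braidVariety_append_iff β₁ β₂ z).1 hz).trans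
      (h.trans ((mem_braidVariety_append_iff β₁ β₂ z').1 hz').symm)
    rw [wordGL_mul_permGL_w0, wordGL_mul_permGL_w0] at e
    funext k
    induction k using Fin.addCases with
    | left k =>
      have a := (hζ₁ fun k => z (Fin.castAdd l₂ k)).2 k
      have b := (hζ₁ fun k => z' (Fin.castAdd l₂ k)).2 k
      rw [one_mul] at a b
      exact a.symm.trans ((congrArg (ζ₁ k) h).trans b)
    | right k =>
      have a := (hζ₂ fun k => -z (Fin.natAdd l₁ k.rev)).2 k.rev
      have b := (hζ₂ fun k => -z' (Fin.natAdd l₁ k.rev)).2 k.rev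
      rw [e, b] at a
      simpa using a.symm
  · rintro F ⟨hF, hF'⟩
    obtain ⟨A, rfl⟩ := flagOf_surjective F
    obtain ⟨z₁, e₁⟩ := (flagOf_mem_schubertCell_iff h₁ A).1 hF
    obtain ⟨z₂, e₂⟩ := (flagOf_mem_oppositeSchubertCell_iff_exists h₂ A).1 hF'
    refine ⟨Fin.append z₁ z₂, ?_, ?_⟩
    · rw [mem_braidVariety_append_iff]
      simpa using e₂.symm.trans e₁
    · simpa [braidFlag] using e₁.symm

/-- The isomorphism of a braid variety of two reduced words with an open Richardson variety. -/
theorem exists_iso_braidFlag {β₁ : PositiveWord n l₁} {β₂ : PositiveWord n l₂}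
    (h₁ : IsReducedWord β₁) (h₂ : IsReducedWord β₂) :
    ∃ φ : SpaceWithFunctions.Iso (braidVarietySpace (Fin.append β₁ β₂) (w0 n))
        (flagSubspace (schubertCell (coxeter β₁) ∩
          oppositeSchubertCell (w0 n * (coxeter β₂)⁻¹))),
      ∀ z : braidVariety (Fin.append β₁ β₂) (w0 n),
        (φ.toEquiv z : CompleteFlag n) = braidFlag β₁ l₂ z := by
  have hbij := bijOn_braidFlag h₁ h₂
  let e := hbij.equiv
  have he : ∀ z, (e z : CompleteFlag n) = braidFlag β₁ l₂ z := fun z => rfl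
  have he' : ∀ F, braidFlag β₁ l₂ (e.symm F) = F := fun F => by rw [← he, e.apply_symm_apply]
  refine ⟨⟨e, ?_, ?_⟩, he⟩
  · exact SpaceWithFunctions.IsMorphism.to_induced
      ((isMorphism_braidFlag β₁ l₂).comp (SpaceWithFunctions.isMorphism_induced _ _))
  · refine SpaceWithFunctions.IsMorphism.to_induced (SpaceWithFunctions.isMorphism_affine _ ?_)
    intro k
    induction k using Fin.addCases with
    | left k =>
      obtain ⟨W, ζ, hW, hζ, hζz⟩ := exists_regular_parameter h₁ 1
      have key : ∀ F : ↥(schubertCell (coxeter β₁) ∩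
          oppositeSchubertCell (w0 n * (coxeter β₂)⁻¹)), (F : CompleteFlag n) =
          flagOf (1 * (wordGL β₁ fun k => (e.symm F).1 (Fin.castAdd l₂ k))⁻¹) := fun F => by
        rw [one_mul]
        exact (he' F).symm
      refine SpaceWithFunctions.isRegularOn_restrict _ hW (fun F hF => ?_) (hζ k) fun F => ?_
      · have h := (hζz fun k => (e.symm ⟨F, hF⟩).1 (Fin.castAdd l₂ k)).1
        rwa [← key] at h
      · have h := (hζz fun k => (e.symm F).1 (Fin.castAdd l₂ k)).2 k
        rw [← key] at h
        exact h.symm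
    | right k =>
      obtain ⟨W, ζ, hW, hζ, hζz⟩ := exists_regular_parameter h₂.starWord (permGL (w0 n))
      have key : ∀ F : ↥(schubertCell (coxeter β₁) ∩
          oppositeSchubertCell (w0 n * (coxeter β₂)⁻¹)), (F : CompleteFlag n) = flagOf (permGL (w0 n) *
          (wordGL (starWord β₂) fun k => -(e.symm F).1 (Fin.natAdd l₁ k.rev))⁻¹) := fun F => by
        rw [← wordGL_mul_permGL_w0 β₂ fun k => (e.symm F).1 (Fin.natAdd l₁ k),
          (mem_braidVariety_append_iff β₁ β₂ _).1 (e.symm F).2]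
        exact (he' F).symm
      -- The star word reverses and negates the parameters, hence the factor `-1` and the index
      -- `k.rev`.
      refine SpaceWithFunctions.isRegularOn_restrict _ hW (fun F hF => ?_)
        ((flagVariety n).mul' ((flagVariety n).const' (-1) W) (hζ k.rev)) fun F => ?_
      · have h := (hζz fun k => -(e.symm ⟨F, hF⟩).1 (Fin.natAdd l₁ k.rev)).1
        rwa [← key] at h
      · have h := (hζz fun k => -(e.symm F).1 (Fin.natAdd l₁ k.rev)).2 k.rev
        rw [← key F] at h
        rw [h]
        simp [e]

end BraidRichardson

end

theorem theorem4p3 (n : ℕ) :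
    (∀ (l₁ l₂ : ℕ) (β₁ : PositiveWord n l₁) (β₂ : PositiveWord n l₂),
      IsReducedWord β₁ → IsReducedWord β₂ →
      ∃ φ : SpaceWithFunctions.Iso
          (braidVarietySpace (Fin.append β₁ β₂) (w0 n))
          (flagSubspace (schubertCell (coxeter β₁) ∩
            oppositeSchubertCell (w0 n * (coxeter β₂)⁻¹))),
        ∀ z : braidVariety (Fin.append β₁ β₂) (w0 n),
          (φ.toEquiv z : CompleteFlag n) =
            flagOf (wordGL β₁ fun k => (z : Fin (l₁ + l₂) → ℂ) (Fin.castAdd l₂ k))⁻¹) ∧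
    (∀ u w : Equiv.Perm (Fin n),
      (∃ (l₁ l₂ : ℕ) (β₁ : PositiveWord n l₁) (β₂ : PositiveWord n l₂),
        IsReducedWordOf β₁ w ∧ IsReducedWordOf β₂ (u⁻¹ * w0 n)) ∧
      ∀ (l₁ l₂ : ℕ) (β₁ : PositiveWord n l₁) (β₂ : PositiveWord n l₂),
        IsReducedWordOf β₁ w → IsReducedWordOf β₂ (u⁻¹ * w0 n) →
        Nonempty (SpaceWithFunctions.Iso
          (braidVarietySpace (Fin.append β₁ β₂) (w0 n))
          (flagSubspace (openRichardson u w)))) := by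
  refine ⟨fun l₁ l₂ β₁ β₂ h₁ h₂ => exists_iso_braidFlag h₁ h₂, fun u w => ⟨?_, ?_⟩⟩
  · obtain ⟨l₁, β₁, h₁⟩ := exists_isReducedWordOf w
    obtain ⟨l₂, β₂, h₂⟩ := exists_isReducedWordOf (u⁻¹ * w0 n)
    exact ⟨l₁, l₂, β₁, β₂, h₁, h₂⟩
  · rintro l₁ l₂ β₁ β₂ ⟨h₁, rfl⟩ ⟨h₂, hu⟩
    obtain ⟨φ, -⟩ := exists_iso_braidFlag h₁ h₂
    have hw : w0 n * (coxeter β₂)⁻¹ = u := by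
      rw [hu, mul_inv_rev, inv_inv, mul_inv_cancel_left]
    rw [hw] at φ
    exact ⟨φ⟩
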